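/- Let $\alpha\in\mathbb R$ and $\beta>-1$. Let $\mathcal Y_{\alpha,\beta}$ denote the class of all transcendental meromorphic functions $f$ in $\mathbb C$ such that the family $(f_h)_{|h|\ge 1}$ of rescaled functions $$f_h(z)=h^{-\alpha}f(h+h^{-\beta}z)$$ (with the principal determination of the powers of $h$) is normal in $\mathbb C$ with respect to the spherical metric, and such that no limit function $\lim_{n\to\infty}f_{h_n}$ with $h_n\to\infty$ (the convergence being locally uniform in $\mathbb C$ with respect to the spherical metric) is a constant, finite or $\infty$. For $f$ meromorphic in $\mathbb C$ and $r>0$ let $n(r,0)$ and $n(r,\infty)$ denote the number of zeros and the number of poles of $f$, respectively, in $|z|<r$, counted with multiplicity. Let $T(r,f)$ be the Nevanlinna characteristic of $f$, and let $$\varrho(f)=\limsup_{r\to\infty}\frac{\log T(r,f)}{\log r}$$ be the order of growth of $f$. Write $\phi(r)\asymp\psi(r)$ if $\phi(r)=O(\psi(r))$ and $\psi(r)=O(\phi(r))$ as $r\to\infty$. **Theorem.** Every $f\in\mathcal Y_{\alpha,\beta}$ satisfies $$n(r,0)\asymp r^{2\beta+2}\quad\text{and}\quad n(r,\infty)\asymp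 r^{2\beta+2}.$$ In particular, $f$ has order of growth $\varrho(f)=2\beta+2$. -/

import Mathlib

open Filter Topology Asymptotics

noncomputable section

namespace GeneralisedYosida

/-- The value in the Riemann sphere `ℂ ∪ {∞}` of a meromorphic function `f` at `z`: the limit of
`f w` as `w → z`, `w ≠ z`, taken in the sphere. It is `∞` exactly at the poles, and it does not
depend on the values that `f : ℂ → ℂ` happens to have at poles or removable singularities. -/
def sphereValue (f : ℂ → ℂ) (z : ℂ) : OnePoint ℂ :=
  limUnder (𝓝[≠] z) (fun w => (f w : OnePoint ℂ))

/-- The chordal (spherical) metric on the Riemann sphere. -/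
def chordalDist : OnePoint ℂ → OnePoint ℂ → ℝ
  | .some z, .some w => ‖z - w‖ / (√(1 + ‖z‖ ^ 2) * √(1 + ‖w‖ ^ 2))
  | .some z, .infty => 1 / √(1 + ‖z‖ ^ 2)
  | .infty, .some w => 1 / √(1 + ‖w‖ ^ 2)
  | .infty, .infty => 0

/-- Locally uniform convergence in `ℂ`, with respect to the spherical metric, of a sequence of
sphere-valued functions: uniform convergence on every compact set. -/
def SphericallyConverges (F : ℕ → ℂ → OnePoint ℂ) (φ : ℂ → OnePoint ℂ) : Prop :=
  ∀ K : Set ℂ, IsCompact K → ∀ ε : ℝ, 0 < ε →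
    ∀ᶠ n in atTop, ∀ z ∈ K, chordalDist (F n z) (φ z) < ε

/-- The rescaled function `f_h(z) = h^{-α} f(h + h^{-β} z)`, with the principal determination of
the powers of `h`. -/
def rescale (α β : ℝ) (f : ℂ → ℂ) (h : ℂ) (z : ℂ) : ℂ :=
  h ^ (-(α : ℂ)) * f (h + h ^ (-(β : ℂ)) * z)

/-- `f` is, as a meromorphic function, a rational function. -/
def IsRationalFunction (f : ℂ → ℂ) : Prop :=
  ∃ p q : Polynomial ℂ, q ≠ 0 ∧ f =ᶠ[codiscrete ℂ] fun z => p.eval z / q.eval z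

/-- The class of generalised Yosida functions with parameters `α` real and `β > -1`. -/
structure IsGeneralisedYosida (α β : ℝ) (f : ℂ → ℂ) : Prop where
  /-- `f` is meromorphic in the plane -/
  meromorphic : Meromorphic f
  /-- `f` is transcendental -/
  transcendental : ¬ IsRationalFunction f
  /-- the family of all `f_h` with `|h| ≥ 1` is normal in `ℂ` -/
  normal : ∀ h : ℕ → ℂ, (∀ n, 1 ≤ ‖h n‖) →
    ∃ (s : ℕ → ℕ) (φ : ℂ → OnePoint ℂ), StrictMono s ∧
      SphericallyConverges (fun n => sphereValue (rescale α β f (h (s n)))) φ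
  /-- no limit function, as `h → ∞`, is constant (finite or infinite) -/
  limit_not_constant : ∀ (h : ℕ → ℂ) (φ : ℂ → OnePoint ℂ), (∀ n, 1 ≤ ‖h n‖) →
    Tendsto (fun n => ‖h n‖) atTop atTop →
    SphericallyConverges (fun n => sphereValue (rescale α β f (h n))) φ →
    ¬ ∃ c : OnePoint ℂ, ∀ z, φ z = c

/-- `n(r, 0)`: the number of zeros of `f` in `|z| < r`, counted with multiplicity. -/
def zeroCount (f : ℂ → ℂ) (r : ℝ) : ℤ :=
  ∑ᶠ z ∈ Metric.ball (0 : ℂ) r, (MeromorphicOn.divisor f Set.univ)⁺ z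

/-- `n(r, ∞)`: the number of poles of `f` in `|z| < r`, counted with multiplicity. -/
def poleCount (f : ℂ → ℂ) (r : ℝ) : ℤ :=
  ∑ᶠ z ∈ Metric.ball (0 : ℂ) r, (MeromorphicOn.divisor f Set.univ)⁻ z

/-- The order of growth: the upper limit of `log T(r, f) / log r` as `r → ∞`, where `T` is the
Nevanlinna characteristic. It is an extended real number. -/
def orderOfGrowth (f : ℂ → ℂ) : EReal :=
  limsup (fun r : ℝ =>
    ((Real.log (ValueDistribution.characteristic f ⊤ r) / Real.log r : ℝ) : EReal)) atTop

end GeneralisedYosida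

end

/-!
# Zeros, poles and order of generalised Yosida functions

The proof compares `f` with the limits of its rescalings `f_h`.

*Upper bound for the counts.* Near any point, the solutions of `f_{h_n} = a_n` with `|a_n| ≤ 1` are
bounded in number when `f_{h_n}` tends to a nonconstant limit. This follows from Jensen's formula,
see `exists_sum_zeroMult_le_of_limit`. Normality turns this into a uniform bound: for large `|h|`,
the disc of radius `δ |h|^{-β}` about `h` contains at most `N` zeros of `f`.

*Lower bound for the counts.* For a suitable `R`, every disc of radius `R |h|^{-β}` about a far away
point `h` contains a zero (`IsGeneralisedYosida.exists_zero`). If not, some limit function is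
zero-free by Hurwitz's theorem, hence comes arbitrarily close to `0` by Liouville's theorem.
Rescaling about the points where this happens gives another limit function, which is again
zero-free, but vanishes at `0`.

*Globalisation.* About `r^{2β+2}` discs of radius `r^{-β}` fit into a disc of radius `r`. The
lemmas `exists_disc_bound` and `exists_disc_lower_bound` make this precise by averaging over the
centres instead of choosing a covering. Poles of `f` are zeros of `f⁻¹`, which is in the class with
`-α` in place of `α`.

*Order.* The characteristic dominates the logarithmic counting function of the poles. In the other
direction, Cartan's formula bounds it by an average of counting functions of the points with
`f = a`, `|a| = 1`, which obey the same upper bound when `α ≥ 0`; the case `α ≤ 0` follows by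
passing to `f⁻¹`. So `T(r, f)` lies between constant multiples of `r^{2β+2}` and
`r^{2β+2} log r`.
-/

namespace GeneralisedYosida

noncomputable section

/-! ### Stereographic coordinates on the Riemann sphere -/

section

/-- The complex coordinate of the stereographic embedding of `ℂ ∪ {∞}` onto the sphere of
radius `1 / 2` in `ℂ × ℝ` that touches the plane `height = 0` at the image `(0, 0)` of `∞`. -/
def sphU (p : OnePoint ℂ) : ℂ := p.elim 0 fun z => z / (1 + ‖z‖ ^ 2 : ℝ)

/-- The height coordinate of the stereographic embedding: it is `0` at `∞`, and `1` at `0`. -/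
def sphV (p : OnePoint ℂ) : ℝ := p.elim 0 fun z => 1 / (1 + ‖z‖ ^ 2)

/-- The complex number that a point of the sphere stands for, with the junk value `0` at `∞`. -/
def finiteVal (p : OnePoint ℂ) : ℂ := p.elim 0 id

open Classical in
/-- The inversion `z ↦ z⁻¹` of the Riemann sphere, which exchanges `0` and `∞`. -/
def sphInv (p : OnePoint ℂ) : OnePoint ℂ :=
  p.elim ((0 : ℂ) : OnePoint ℂ) fun z => if z = 0 then OnePoint.infty else ((z⁻¹ : ℂ) : OnePoint ℂ)

@[simp] lemma sphU_infty : sphU OnePoint.infty = 0 := rfl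
@[simp] lemma sphU_coe (z : ℂ) : sphU (z : OnePoint ℂ) = z / (1 + ‖z‖ ^ 2 : ℝ) := rfl
@[simp] lemma sphV_infty : sphV OnePoint.infty = 0 := rfl
@[simp] lemma sphV_coe (z : ℂ) : sphV (z : OnePoint ℂ) = 1 / (1 + ‖z‖ ^ 2) := rfl
@[simp] lemma finiteVal_infty : finiteVal OnePoint.infty = 0 := rfl
@[simp] lemma finiteVal_coe (z : ℂ) : finiteVal (z : OnePoint ℂ) = z := rfl
@[simp] lemma sphInv_infty : sphInv OnePoint.infty = ((0 : ℂ) : OnePoint ℂ) := rfl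
@[simp] lemma sphInv_zero : sphInv ((0 : ℂ) : OnePoint ℂ) = OnePoint.infty := by
  simp [sphInv]
lemma sphInv_coe {z : ℂ} (hz : z ≠ 0) : sphInv (z : OnePoint ℂ) = ((z⁻¹ : ℂ) : OnePoint ℂ) := by
  simp [sphInv, hz]

lemma chordalDist_coe_coe (z w : ℂ) :
    chordalDist (z : OnePoint ℂ) (w : OnePoint ℂ) =
      ‖z - w‖ / (√(1 + ‖z‖ ^ 2) * √(1 + ‖w‖ ^ 2)) := rfl

lemma chordalDist_coe_infty (z : ℂ) :
    chordalDist (z : OnePoint ℂ) OnePoint.infty = 1 / √(1 + ‖z‖ ^ 2) := rfl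

lemma chordalDist_infty_coe (z : ℂ) :
    chordalDist OnePoint.infty (z : OnePoint ℂ) = 1 / √(1 + ‖z‖ ^ 2) := rfl

lemma chordalDist_infty_infty : chordalDist OnePoint.infty OnePoint.infty = 0 := rfl

lemma chordalDist_nonneg (p q : OnePoint ℂ) : 0 ≤ chordalDist p q := by
  induction p using OnePoint.rec <;> induction q using OnePoint.rec <;>
    simp only [chordalDist_coe_coe, chordalDist_coe_infty, chordalDist_infty_coe,
      chordalDist_infty_infty] <;> positivity

lemma chordalDist_self (p : OnePoint ℂ) : chordalDist p p = 0 := by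
  induction p using OnePoint.rec <;> simp [chordalDist_coe_coe, chordalDist_infty_infty]

/-- The chordal distance is the Euclidean distance of the stereographic images. -/
lemma norm_sphU_sub_sq_add (p q : OnePoint ℂ) :
    ‖sphU p - sphU q‖ ^ 2 + (sphV p - sphV q) ^ 2 = chordalDist p q ^ 2 := by
  have key : ∀ z : ℂ, ‖z / ((1 + ‖z‖ ^ 2 : ℝ) : ℂ)‖ ^ 2 + (1 / (1 + ‖z‖ ^ 2)) ^ 2
      = 1 / (1 + ‖z‖ ^ 2) := by
    intro z
    have h : (0 : ℝ) < 1 + ‖z‖ ^ 2 := by positivity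
    rw [norm_div, Complex.norm_real, Real.norm_of_nonneg h.le]
    field_simp
    ring
  induction p using OnePoint.rec with
  | infty =>
    induction q using OnePoint.rec with
    | infty => simp [chordalDist_infty_infty]
    | coe w =>
      have h : (0 : ℝ) ≤ 1 + ‖w‖ ^ 2 := by positivity
      simp only [sphU_infty, sphU_coe, sphV_infty, sphV_coe, zero_sub, norm_neg, neg_sq,
        chordalDist_infty_coe]
      rw [key, div_pow, Real.sq_sqrt h, one_pow]
  | coe z =>
    induction q using OnePoint.rec with
    | infty =>
      have h : (0 : ℝ) ≤ 1 + ‖z‖ ^ 2 := by positivity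
      simp only [sphU_infty, sphU_coe, sphV_infty, sphV_coe, sub_zero,
        chordalDist_coe_infty]
      rw [key, div_pow, Real.sq_sqrt h, one_pow]
    | coe w =>
      simp only [sphU_coe, sphV_coe, chordalDist_coe_coe]
      have hz : (0 : ℝ) < 1 + ‖z‖ ^ 2 := by positivity
      have hw : (0 : ℝ) < 1 + ‖w‖ ^ 2 := by positivity
      rw [div_pow, mul_pow, Real.sq_sqrt hz.le, Real.sq_sqrt hw.le]
      have e : z / ((1 + ‖z‖ ^ 2 : ℝ) : ℂ) - w / ((1 + ‖w‖ ^ 2 : ℝ) : ℂ) =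
          ((z.re / (1 + ‖z‖ ^ 2) - w.re / (1 + ‖w‖ ^ 2) : ℝ) : ℂ)
            + ((z.im / (1 + ‖z‖ ^ 2) - w.im / (1 + ‖w‖ ^ 2) : ℝ) : ℂ) * Complex.I := by
        apply Complex.ext <;> simp [Complex.div_ofReal_re, Complex.div_ofReal_im,
          -Complex.ofReal_add, -Complex.ofReal_pow, -Complex.ofReal_sub, -Complex.ofReal_div]
      rw [e, Complex.sq_norm, Complex.normSq_add_mul_I]
      have hzn : ‖z‖ ^ 2 = z.re ^ 2 + z.im ^ 2 := by
        rw [Complex.sq_norm, Complex.normSq_apply]; ring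
      have hwn : ‖w‖ ^ 2 = w.re ^ 2 + w.im ^ 2 := by
        rw [Complex.sq_norm, Complex.normSq_apply]; ring
      have hd : ‖z - w‖ ^ 2 = (z.re - w.re) ^ 2 + (z.im - w.im) ^ 2 := by
        rw [Complex.sq_norm, Complex.normSq_apply]; simp; ring
      rw [hzn] at hz
      rw [hwn] at hw
      rw [hzn, hwn, hd]
      field_simp
      ring

lemma norm_sphU_sub_le (p q : OnePoint ℂ) : ‖sphU p - sphU q‖ ≤ chordalDist p q := by
  refine abs_le_of_sq_le_sq' ?_ (chordalDist_nonneg p q) |>.2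
  rw [← norm_sphU_sub_sq_add]
  exact le_add_of_nonneg_right (sq_nonneg _)

lemma abs_sphV_sub_le (p q : OnePoint ℂ) : |sphV p - sphV q| ≤ chordalDist p q := by
  refine abs_le_of_sq_le_sq' ?_ (chordalDist_nonneg p q) |>.2
  rw [← norm_sphU_sub_sq_add, sq_abs]
  exact le_add_of_nonneg_left (sq_nonneg _)

lemma sphV_nonneg (p : OnePoint ℂ) : 0 ≤ sphV p := by
  induction p using OnePoint.rec with
  | infty => simp
  | coe z => simp only [sphV_coe]; positivity

lemma sphV_pos_iff {p : OnePoint ℂ} : 0 < sphV p ↔ p ≠ OnePoint.infty := by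
  induction p using OnePoint.rec with
  | infty => simp
  | coe z => simp only [sphV_coe]; simp; positivity

lemma finiteVal_eq_div (p : OnePoint ℂ) : finiteVal p = sphU p / sphV p := by
  induction p using OnePoint.rec with
  | infty => simp
  | coe z =>
    have h : ((1 + ‖z‖ ^ 2 : ℝ) : ℂ) ≠ 0 := by
      rw [Complex.ofReal_ne_zero]; positivity
    simp only [finiteVal_coe, sphU_coe, sphV_coe, Complex.ofReal_div, Complex.ofReal_one]
    field_simp

lemma norm_sphU_le_one (p : OnePoint ℂ) : ‖sphU p‖ ≤ 1 := by
  induction p using OnePoint.rec with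
  | infty => simp
  | coe z =>
    have h : (0 : ℝ) < 1 + ‖z‖ ^ 2 := by positivity
    rw [sphU_coe, norm_div, Complex.norm_real, Real.norm_of_nonneg h.le, div_le_one h]
    nlinarith [sq_nonneg (‖z‖ - 1)]

lemma coe_finiteVal {p : OnePoint ℂ} (hp : p ≠ OnePoint.infty) :
    ((finiteVal p : ℂ) : OnePoint ℂ) = p := by
  induction p using OnePoint.rec with
  | infty => exact absurd rfl hp
  | coe z => rfl

lemma continuous_sphV : Continuous sphV := by
  rw [continuous_iff_continuousAt]
  intro p
  induction p using OnePoint.rec with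
  | infty =>
    rw [OnePoint.continuousAt_infty', coclosedCompact_eq_cocompact]
    change Tendsto (fun z : ℂ => 1 / (1 + ‖z‖ ^ 2)) (cocompact ℂ) (𝓝 0)
    have : Tendsto (fun z : ℂ => 1 + ‖z‖ ^ 2) (cocompact ℂ) atTop :=
      tendsto_atTop_add_const_left _ _
        ((tendsto_pow_atTop two_ne_zero).comp tendsto_norm_cocompact_atTop)
    exact this.inv_tendsto_atTop.congr fun z => by simp
  | coe z =>
    rw [OnePoint.continuousAt_coe]
    change ContinuousAt (fun z : ℂ => 1 / (1 + ‖z‖ ^ 2)) z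
    have h : (1 + ‖z‖ ^ 2 : ℝ) ≠ 0 := by positivity
    exact continuousAt_const.div (by fun_prop) h

lemma sphInv_ne_infty_iff {p : OnePoint ℂ} :
    sphInv p ≠ OnePoint.infty ↔ p ≠ ((0 : ℂ) : OnePoint ℂ) := by
  induction p using OnePoint.rec with
  | infty => simp
  | coe z =>
    rcases eq_or_ne z 0 with rfl | hz
    · simp
    · simp [sphInv_coe hz, hz]

lemma sphInv_sphInv (p : OnePoint ℂ) : sphInv (sphInv p) = p := by
  induction p using OnePoint.rec with
  | infty => simp
  | coe z =>
    rcases eq_or_ne z 0 with rfl | hz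
    · simp
    · rw [sphInv_coe hz, sphInv_coe (inv_ne_zero hz), inv_inv]

lemma sphV_sphInv (p : OnePoint ℂ) : sphV (sphInv p) = 1 - sphV p := by
  induction p using OnePoint.rec with
  | infty => simp
  | coe z =>
    rcases eq_or_ne z 0 with rfl | hz
    · simp
    · have : 0 < ‖z‖ := norm_pos_iff.2 hz
      simp only [sphInv_coe hz, sphV_coe, norm_inv]
      field_simp
      ring

/-- In stereographic coordinates the inversion is the isometry `(u, v) ↦ (conj u, 1 - v)`. -/
lemma sphU_sphInv (p : OnePoint ℂ) : sphU (sphInv p) = (starRingEnd ℂ) (sphU p) := by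
  induction p using OnePoint.rec with
  | infty => simp
  | coe z =>
    rcases eq_or_ne z 0 with rfl | hz
    · simp
    · have h0 : 0 < ‖z‖ := norm_pos_iff.2 hz
      have h1 : (‖z‖ : ℂ) ≠ 0 := by exact_mod_cast h0.ne'
      have h2 : (1 + (‖z‖ : ℂ) ^ 2) ≠ 0 := by
        have : (0 : ℝ) < 1 + ‖z‖ ^ 2 := by positivity
        exact_mod_cast this.ne'
      have h3 : (1 + (‖z‖⁻¹ : ℂ) ^ 2) ≠ 0 := by
        have : (0 : ℝ) < 1 + ‖z‖⁻¹ ^ 2 := by positivity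
        exact_mod_cast this.ne'
      simp only [sphInv_coe hz, sphU_coe, norm_inv, map_div₀, Complex.conj_ofReal]
      have h4 : z * (starRingEnd ℂ) z = (‖z‖ : ℂ) ^ 2 := by
        rw [Complex.mul_conj, Complex.normSq_eq_norm_sq]; push_cast; rfl
      push_cast
      rw [div_eq_div_iff h3 h2]
      field_simp
      rw [← h4]
      ring

lemma chordalDist_sphInv (p q : OnePoint ℂ) :
    chordalDist (sphInv p) (sphInv q) = chordalDist p q := by
  refine (sq_eq_sq₀ (chordalDist_nonneg _ _) (chordalDist_nonneg _ _)).1 ?_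
  rw [← norm_sphU_sub_sq_add, ← norm_sphU_sub_sq_add, sphV_sphInv, sphV_sphInv, sphU_sphInv,
    sphU_sphInv, ← map_sub, Complex.norm_conj]
  ring

/-! ### Sphere values of meromorphic functions -/

lemma sphereValue_eq_of_tendsto {g : ℂ → ℂ} {z : ℂ} {p : OnePoint ℂ}
    (h : Tendsto (fun w => (g w : OnePoint ℂ)) (𝓝[≠] z) (𝓝 p)) : sphereValue g z = p :=
  h.limUnder_eq

lemma sphereValue_eq_coe {g : ℂ → ℂ} {z c : ℂ} (h : Tendsto g (𝓝[≠] z) (𝓝 c)) :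
    sphereValue g z = (c : OnePoint ℂ) :=
  sphereValue_eq_of_tendsto (OnePoint.continuous_coe.continuousAt.tendsto.comp h)

lemma sphereValue_eq_infty {g : ℂ → ℂ} {z : ℂ}
    (h : Tendsto g (𝓝[≠] z) (Bornology.cobounded ℂ)) : sphereValue g z = OnePoint.infty := by
  apply sphereValue_eq_of_tendsto
  rw [Metric.cobounded_eq_cocompact, ← coclosedCompact_eq_cocompact] at h
  exact OnePoint.tendsto_coe_infty.comp h

lemma tendsto_sphereValue {g : ℂ → ℂ} {z : ℂ} (hg : MeromorphicAt g z) :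
    Tendsto (fun w => (g w : OnePoint ℂ)) (𝓝[≠] z) (𝓝 (sphereValue g z)) := by
  rcases lt_or_ge (meromorphicOrderAt g z) 0 with ho | ho
  · have h := tendsto_cobounded_of_meromorphicOrderAt_neg ho
    rw [sphereValue_eq_infty h]
    rw [Metric.cobounded_eq_cocompact, ← coclosedCompact_eq_cocompact] at h
    exact OnePoint.tendsto_coe_infty.comp h
  · obtain ⟨c, hc⟩ := tendsto_nhds_of_meromorphicOrderAt_nonneg hg ho
    rw [sphereValue_eq_coe hc]
    exact OnePoint.continuous_coe.continuousAt.tendsto.comp hc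

lemma tendsto_finiteVal_sphereValue {g : ℂ → ℂ} {z : ℂ} (hg : MeromorphicAt g z)
    (h : sphereValue g z ≠ OnePoint.infty) :
    Tendsto g (𝓝[≠] z) (𝓝 (finiteVal (sphereValue g z))) := by
  have h1 := tendsto_sphereValue hg
  rw [← coe_finiteVal h] at h1
  exact (OnePoint.isOpenEmbedding_coe.isInducing.tendsto_nhds_iff).2 h1

lemma sphereValue_eq_infty_iff {g : ℂ → ℂ} {z : ℂ} (hg : MeromorphicAt g z) :
    sphereValue g z = OnePoint.infty ↔ meromorphicOrderAt g z < 0 := by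
  refine ⟨fun h => ?_, fun h =>
    sphereValue_eq_infty (tendsto_cobounded_of_meromorphicOrderAt_neg h)⟩
  by_contra! ho
  obtain ⟨c, hc⟩ := tendsto_nhds_of_meromorphicOrderAt_nonneg hg ho
  rw [sphereValue_eq_coe hc] at h
  exact OnePoint.coe_ne_infty _ h

lemma sphereValue_eq_zero_iff {g : ℂ → ℂ} {z : ℂ} (hg : MeromorphicAt g z) :
    sphereValue g z = ((0 : ℂ) : OnePoint ℂ) ↔ 0 < meromorphicOrderAt g z := by
  rw [← tendsto_zero_iff_meromorphicOrderAt_pos hg]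
  refine ⟨fun h => ?_, sphereValue_eq_coe⟩
  have := tendsto_finiteVal_sphereValue hg (by simp [h])
  rwa [h] at this

lemma sphereValue_of_analyticAt {g : ℂ → ℂ} {z : ℂ} (hg : AnalyticAt ℂ g z) :
    sphereValue g z = (g z : OnePoint ℂ) :=
  sphereValue_eq_coe (hg.continuousAt.tendsto.mono_left nhdsWithin_le_nhds)

lemma eventually_sphereValue_eq {g : ℂ → ℂ} {z : ℂ} (hg : MeromorphicAt g z) :
    ∀ᶠ w in 𝓝[≠] z, sphereValue g w = (g w : OnePoint ℂ) := by
  filter_upwards [hg.eventually_analyticAt] with w hw using sphereValue_of_analyticAt hw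

lemma continuous_sphereValue {g : ℂ → ℂ} (hg : Meromorphic g) : Continuous (sphereValue g) := by
  rw [continuous_iff_continuousAt]
  intro z
  rw [continuousAt_iff_punctured_nhds]
  exact (tendsto_sphereValue (hg z)).congr' ((eventually_sphereValue_eq (hg z)).mono
    fun w hw => hw.symm)

lemma eventuallyEq_finiteVal {g : ℂ → ℂ} {z : ℂ} (hg : MeromorphicAt g z) :
    g =ᶠ[𝓝[≠] z] fun w => finiteVal (sphereValue g w) := by
  filter_upwards [eventually_sphereValue_eq hg] with w hw
  rw [hw, finiteVal_coe]

/-- Away from the poles, the finite part of the sphere value is the analytic function obtained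
from `g` by removing its removable singularities. -/
lemma analyticAt_finiteVal {g : ℂ → ℂ} {z : ℂ} (hg : Meromorphic g)
    (h : sphereValue g z ≠ OnePoint.infty) :
    AnalyticAt ℂ (fun w => finiteVal (sphereValue g w)) z := by
  refine MeromorphicAt.analyticAt ((hg z).congr (eventuallyEq_finiteVal (hg z))) ?_
  rw [continuousAt_iff_punctured_nhds]
  exact (tendsto_finiteVal_sphereValue (hg z) h).congr' (eventuallyEq_finiteVal (hg z))

lemma sphereValue_inv {g : ℂ → ℂ} {z : ℂ} (hg : MeromorphicAt g z)
    (h0 : meromorphicOrderAt g z ≠ ⊤) : sphereValue g⁻¹ z = sphInv (sphereValue g z) := by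
  rcases lt_trichotomy (meromorphicOrderAt g z) 0 with ho | ho | ho
  · rw [(sphereValue_eq_infty_iff hg).2 ho, sphInv_infty, sphereValue_eq_zero_iff hg.inv,
      meromorphicOrderAt_inv]
    lift meromorphicOrderAt g z to ℤ using h0 with n
    norm_cast at ho ⊢
    omega
  · obtain ⟨c, c0, hc⟩ := tendsto_ne_zero_of_meromorphicOrderAt_eq_zero hg ho
    rw [sphereValue_eq_coe hc, sphInv_coe c0]
    exact sphereValue_eq_coe (hc.inv₀ c0)
  · rw [(sphereValue_eq_zero_iff hg).2 ho, sphInv_zero, sphereValue_eq_infty_iff hg.inv,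
      meromorphicOrderAt_inv]
    lift meromorphicOrderAt g z to ℤ using h0 with n
    norm_cast at ho ⊢
    omega

end

/-! ### Spherical limits of meromorphic functions -/

section

open Metric

variable {F : ℕ → ℂ → OnePoint ℂ} {g : ℕ → ℂ → ℂ} {φ : ℂ → OnePoint ℂ}

lemma SphericallyConverges.sphInv (h : SphericallyConverges F φ) :
    SphericallyConverges (fun n z => sphInv (F n z)) (fun z => sphInv (φ z)) := by
  intro K hK ε hε
  simpa only [chordalDist_sphInv] using h K hK ε hε

lemma SphericallyConverges.tendstoUniformlyOn_sphV (h : SphericallyConverges F φ) {K : Set ℂ}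
    (hK : IsCompact K) :
    TendstoUniformlyOn (fun n z => sphV (F n z)) (fun z => sphV (φ z)) atTop K := by
  rw [Metric.tendstoUniformlyOn_iff]
  intro ε hε
  filter_upwards [h K hK ε hε] with n hn z hz
  rw [dist_comm, Real.dist_eq]
  exact (abs_sphV_sub_le _ _).trans_lt (hn z hz)

lemma SphericallyConverges.tendstoUniformlyOn_sphU (h : SphericallyConverges F φ) {K : Set ℂ}
    (hK : IsCompact K) :
    TendstoUniformlyOn (fun n z => sphU (F n z)) (fun z => sphU (φ z)) atTop K := by
  rw [Metric.tendstoUniformlyOn_iff]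
  intro ε hε
  filter_upwards [h K hK ε hε] with n hn z hz
  rw [dist_comm, dist_eq_norm]
  exact (norm_sphU_sub_le _ _).trans_lt (hn z hz)

lemma SphericallyConverges.continuous_sphV (h : SphericallyConverges F φ)
    (hF : ∀ n, Continuous (F n)) : Continuous fun z => sphV (φ z) := by
  have : TendstoLocallyUniformly (fun n z => sphV (F n z)) (fun z => sphV (φ z)) atTop := by
    rw [tendstoLocallyUniformly_iff_forall_isCompact]
    exact fun K hK => h.tendstoUniformlyOn_sphV hK
  exact this.continuous
    (Eventually.frequently (Eventually.of_forall fun n => GeneralisedYosida.continuous_sphV.comp (hF n)))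

lemma SphericallyConverges.inv (h : SphericallyConverges (fun n => sphereValue (g n)) φ)
    (hg : ∀ n, Meromorphic (g n)) (hnt : ∀ n z, meromorphicOrderAt (g n) z ≠ ⊤) :
    SphericallyConverges (fun n => sphereValue (g n)⁻¹) (fun z => GeneralisedYosida.sphInv (φ z)) := by
  have := h.sphInv
  convert this using 3 with n z
  exact sphereValue_inv (hg n _) (hnt n _)

lemma norm_finiteVal_le {p : OnePoint ℂ} : ‖finiteVal p‖ ≤ (sphV p)⁻¹ := by
  rw [finiteVal_eq_div, norm_div, Complex.norm_real, Real.norm_of_nonneg (sphV_nonneg p),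
    ← one_div]
  exact div_le_div_of_nonneg_right (norm_sphU_le_one p) (sphV_nonneg p)

/-- Near a point where the spherical limit is finite, spherical convergence is ordinary uniform
convergence of functions that are eventually pole-free and uniformly bounded. -/
lemma exists_closedBall_tendstoUniformlyOn (hg : ∀ n, Meromorphic (g n))
    (h : SphericallyConverges (fun n => sphereValue (g n)) φ) {z₀ : ℂ}
    (hz : φ z₀ ≠ OnePoint.infty) :
    ∃ ρ > 0, ∃ M : ℝ, 0 ≤ M ∧
      (∀ᶠ n in atTop, ∀ z ∈ closedBall z₀ ρ, sphereValue (g n) z ≠ OnePoint.infty ∧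
        ‖finiteVal (sphereValue (g n) z)‖ ≤ M) ∧
      (∀ z ∈ closedBall z₀ ρ, φ z ≠ OnePoint.infty) ∧
      TendstoUniformlyOn (fun n z => finiteVal (sphereValue (g n) z))
        (fun z => finiteVal (φ z)) atTop (closedBall z₀ ρ) := by
  have hc := h.continuous_sphV fun n => continuous_sphereValue (hg n)
  have hpos : 0 < sphV (φ z₀) := sphV_pos_iff.2 hz
  obtain ⟨c, hc0, hc1⟩ := exists_between hpos
  obtain ⟨ρ, hρ, hball⟩ := Metric.nhds_basis_closedBall.eventually_iff.1
    (hc.continuousAt.eventually_const_lt hc1)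
  have hK : IsCompact (closedBall z₀ ρ) := isCompact_closedBall _ _
  have hV := Metric.tendstoUniformlyOn_iff.1 (h.tendstoUniformlyOn_sphV hK)
  have hU := Metric.tendstoUniformlyOn_iff.1 (h.tendstoUniformlyOn_sphU hK)
  have hev : ∀ᶠ n in atTop, ∀ z ∈ closedBall z₀ ρ, c / 2 < sphV (sphereValue (g n) z) := by
    filter_upwards [hV (c / 2) (by positivity)] with n hn z hz
    have h1 := hn z hz
    have h2 := hball hz
    rw [Real.dist_eq, abs_lt] at h1
    linarith
  refine ⟨ρ, hρ, 2 / c, by positivity, ?_, fun z hz => sphV_pos_iff.1 (hc0.trans (hball hz)), ?_⟩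
  · filter_upwards [hev] with n hn z hz
    have h1 := hn z hz
    refine ⟨sphV_pos_iff.1 (lt_trans (by positivity) h1), norm_finiteVal_le.trans ?_⟩
    rw [← one_div, div_le_div_iff₀ (lt_trans (by positivity) h1) hc0]
    linarith
  · -- The finite value is `u / v` in stereographic coordinates, and the heights stay above `c / 2`.
    rw [Metric.tendstoUniformlyOn_iff]
    intro ε hε
    have hη1 : ∃ η > 0, 2 * η / c + 2 * η / c ^ 2 < ε := by
      refine ⟨min (ε * c / 8) (ε * c ^ 2 / 8), by positivity, ?_⟩
      have h1 : 2 * min (ε * c / 8) (ε * c ^ 2 / 8) / c ≤ ε / 4 := by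
        rw [div_le_iff₀ hc0]
        linarith [min_le_left (ε * c / 8) (ε * c ^ 2 / 8)]
      have h2 : 2 * min (ε * c / 8) (ε * c ^ 2 / 8) / c ^ 2 ≤ ε / 4 := by
        rw [div_le_iff₀ (by positivity)]
        linarith [min_le_right (ε * c / 8) (ε * c ^ 2 / 8)]
      linarith
    obtain ⟨η, hη0, hη⟩ := hη1
    filter_upwards [hev, hV η hη0, hU η hη0] with n hn hVn hUn z hz
    have h1 := hn z hz
    have h2 := hball hz
    have h3 := hVn z hz
    have h4 := hUn z hz
    rw [dist_eq_norm] at h4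
    rw [Real.dist_eq] at h3
    rw [dist_eq_norm, finiteVal_eq_div, finiteVal_eq_div]
    set u := sphU (φ z) with hu
    set v := sphV (φ z)
    set u' := sphU (sphereValue (g n) z)
    set v' := sphV (sphereValue (g n) z)
    have hu1 : ‖u‖ ≤ 1 := norm_sphU_le_one _
    have hv0 : 0 < v := hc0.trans h2
    have hv0' : 0 < v' := lt_trans (by positivity) h1
    have e : u / (v : ℂ) - u' / (v' : ℂ) =
        (u - u') / (v' : ℂ) - u * ((v - v' : ℝ) : ℂ) / ((v : ℂ) * (v' : ℂ)) := by
      have : (v : ℂ) ≠ 0 := by exact_mod_cast hv0.ne'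
      have : (v' : ℂ) ≠ 0 := by exact_mod_cast hv0'.ne'
      push_cast
      field_simp
      ring
    have e1 : ‖(u - u') / (v' : ℂ)‖ ≤ 2 * η / c := by
      rw [norm_div, Complex.norm_real, Real.norm_of_nonneg hv0'.le,
        div_le_div_iff₀ hv0' hc0]
      nlinarith [norm_nonneg (u - u')]
    have e2 : ‖u * ((v - v' : ℝ) : ℂ) / ((v : ℂ) * (v' : ℂ))‖ ≤ 2 * η / c ^ 2 := by
      rw [norm_div, norm_mul, norm_mul, Complex.norm_real, Complex.norm_real, Complex.norm_real,
        Real.norm_of_nonneg hv0'.le, Real.norm_of_nonneg hv0.le, Real.norm_eq_abs]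
      have a1 : ‖u‖ * |v - v'| ≤ η := by nlinarith [abs_nonneg (v - v'), norm_nonneg u]
      have a2 : c ^ 2 / 2 ≤ v * v' := by nlinarith
      calc ‖u‖ * |v - v'| / (v * v') ≤ η / (c ^ 2 / 2) := by gcongr
        _ = 2 * η / c ^ 2 := by field_simp
    rw [e]
    exact ((norm_sub_le _ _).trans (add_le_add e1 e2)).trans_lt hη

lemma analyticAt_finiteVal_limit (hg : ∀ n, Meromorphic (g n))
    (h : SphericallyConverges (fun n => sphereValue (g n)) φ) {z₀ : ℂ}
    (hz : φ z₀ ≠ OnePoint.infty) : AnalyticAt ℂ (fun z => finiteVal (φ z)) z₀ := by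
  obtain ⟨ρ, hρ, M, -, hn, -, hU⟩ := exists_closedBall_tendstoUniformlyOn hg h hz
  have hd : DifferentiableOn ℂ (fun z => finiteVal (φ z)) (ball z₀ ρ) := by
    refine TendstoLocallyUniformlyOn.differentiableOn
      (hU.mono ball_subset_closedBall).tendstoLocallyUniformlyOn ?_ isOpen_ball
    filter_upwards [hn] with n hn z hz
    exact (analyticAt_finiteVal (hg n)
      (hn z (ball_subset_closedBall hz)).1).differentiableAt.differentiableWithinAt
  exact hd.analyticAt (isOpen_ball.mem_nhds (mem_ball_self hρ))

lemma limit_eventually_ne_infty (hg : ∀ n, Meromorphic (g n))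
    (h : SphericallyConverges (fun n => sphereValue (g n)) φ) {z₀ : ℂ}
    (hz : φ z₀ ≠ OnePoint.infty) : ∀ᶠ z in 𝓝 z₀, φ z ≠ OnePoint.infty := by
  obtain ⟨ρ, hρ, M, -, -, hn, -⟩ := exists_closedBall_tendstoUniformlyOn hg h hz
  exact mem_of_superset (closedBall_mem_nhds z₀ hρ) hn

lemma limit_eventually_eq_coe (hg : ∀ n, Meromorphic (g n))
    (h : SphericallyConverges (fun n => sphereValue (g n)) φ) {z₀ c : ℂ}
    (hz : φ z₀ ≠ OnePoint.infty) (hc : ∀ᶠ z in 𝓝 z₀, finiteVal (φ z) = c) :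
    ∀ᶠ z in 𝓝 z₀, φ z = (c : OnePoint ℂ) := by
  filter_upwards [hc, limit_eventually_ne_infty hg h hz] with z h1 h2
  rw [← coe_finiteVal h2, h1]

lemma limit_eq_coe_of_eventually (hg : ∀ n, Meromorphic (g n))
    (h : SphericallyConverges (fun n => sphereValue (g n)) φ) {z₁ c : ℂ}
    (hp : ∀ᶠ z in 𝓝 z₁, φ z = (c : OnePoint ℂ)) (z : ℂ) : φ z = (c : OnePoint ℂ) := by
  have hcont := h.continuous_sphV fun n => continuous_sphereValue (hg n)
  -- The set where the limit is locally equal to `c` is open and closed.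
  set A : Set ℂ := {z | ∀ᶠ w in 𝓝 z, φ w = (c : OnePoint ℂ)} with hA
  have hAo : IsOpen A := isOpen_setOfPred_eventually_nhds
  have hAc : IsClosed A := by
    rw [← closure_subset_iff_isClosed]
    intro w hw
    by_contra hwA
    have hV : sphV (φ w) = sphV (c : OnePoint ℂ) := by
      have hcl : IsClosed {w | sphV (φ w) = sphV (c : OnePoint ℂ)} :=
        isClosed_eq hcont continuous_const
      refine closure_minimal (fun x hx => ?_) hcl hw
      simp only [Set.mem_ofPred_eq]
      rw [(hx : ∀ᶠ w in 𝓝 x, _).self_of_nhds]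
    have hfin : φ w ≠ OnePoint.infty := by
      rw [← sphV_pos_iff, hV, sphV_pos_iff]
      exact OnePoint.coe_ne_infty c
    have hfr : ∃ᶠ x in 𝓝[≠] w, finiteVal (φ x) = c := by
      rw [frequently_nhdsWithin_iff]
      refine (mem_closure_iff_frequently.1 hw).mono fun x hx => ⟨?_, ?_⟩
      · rw [(hx : ∀ᶠ w in 𝓝 x, _).self_of_nhds, finiteVal_coe]
      · rintro rfl
        exact hwA hx
    have := ((analyticAt_finiteVal_limit hg h hfin).frequently_eq_iff_eventually_eq
      analyticAt_const).1 hfr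
    exact hwA (limit_eventually_eq_coe hg h hfin this)
  have : A = Set.univ := IsClopen.eq_univ ⟨hAc, hAo⟩ ⟨z₁, hp⟩
  have hz : z ∈ A := this ▸ Set.mem_univ z
  exact (hz : ∀ᶠ w in 𝓝 z, _).self_of_nhds

/-- Identity theorem for spherical limits: a limit that is constant near one point, possibly with
the value `∞`, is constant. -/
lemma limit_eq_of_eventually (hg : ∀ n, Meromorphic (g n))
    (hnt : ∀ n z, meromorphicOrderAt (g n) z ≠ ⊤)
    (h : SphericallyConverges (fun n => sphereValue (g n)) φ) {z₁ : ℂ} {p : OnePoint ℂ}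
    (hp : ∀ᶠ z in 𝓝 z₁, φ z = p) (z : ℂ) : φ z = p := by
  induction p using OnePoint.rec with
  | infty =>
    have := limit_eq_coe_of_eventually (g := fun n => (g n)⁻¹) (c := 0) (fun n => (hg n).inv)
      (h.inv hg hnt) (hp.mono fun z hz => by simp [hz]) z
    rw [← sphInv_sphInv (φ z), this, sphInv_zero]
  | coe c => exact limit_eq_coe_of_eventually hg h hp z

/-- Hurwitz's theorem: if the `g n` have no zeros near `z₀`, a limit that vanishes at `z₀`
vanishes identically near `z₀`. Otherwise the maximum principle for `1 / g n` on a small circle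
keeps `g n z₀` away from `0`. -/
lemma limit_eventually_eq_zero (hg : ∀ n, Meromorphic (g n))
    (h : SphericallyConverges (fun n => sphereValue (g n)) φ) {z₀ : ℂ}
    (hz : φ z₀ = ((0 : ℂ) : OnePoint ℂ))
    (hne : ∀ᶠ n in atTop, ∀ z ∈ closedBall z₀ 1, sphereValue (g n) z ≠ ((0 : ℂ) : OnePoint ℂ)) :
    ∀ᶠ z in 𝓝 z₀, φ z = ((0 : ℂ) : OnePoint ℂ) := by
  have hfin : φ z₀ ≠ OnePoint.infty := by rw [hz]; exact OnePoint.coe_ne_infty 0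
  obtain ⟨ρ, hρ, M, -, hn, hφ, hU⟩ := exists_closedBall_tendstoUniformlyOn hg h hfin
  rcases (analyticAt_finiteVal_limit hg h hfin).eventually_eq_zero_or_eventually_ne_zero with h0 | h0
  · exact limit_eventually_eq_coe hg h hfin h0
  exfalso
  rw [eventually_nhdsWithin_iff] at h0
  obtain ⟨s', hs', hball⟩ := Metric.nhds_basis_closedBall.eventually_iff.1 h0
  set s := min (min s' ρ) 1 with hs
  have hs0 : 0 < s := by positivity
  have hsρ : closedBall z₀ s ⊆ closedBall z₀ ρ :=
    closedBall_subset_closedBall ((min_le_left _ _).trans (min_le_right _ _))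
  have hs1 : closedBall z₀ s ⊆ closedBall z₀ 1 := closedBall_subset_closedBall (min_le_right _ _)
  have hss : closedBall z₀ s ⊆ closedBall z₀ s' :=
    closedBall_subset_closedBall ((min_le_left _ _).trans (min_le_left _ _))
  have hcont : ContinuousOn (fun z => ‖finiteVal (φ z)‖) (sphere z₀ s) := fun z hz =>
    (analyticAt_finiteVal_limit hg h
      (hφ z (hsρ (sphere_subset_closedBall hz)))).continuousAt.norm.continuousWithinAt
  obtain ⟨x, hx, hmin⟩ := (isCompact_sphere z₀ s).exists_isMinOn
    (NormedSpace.sphere_nonempty.2 hs0.le) hcont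
  set m := ‖finiteVal (φ x)‖ with hm
  have hm0 : 0 < m := norm_pos_iff.2 (hball (hss (sphere_subset_closedBall hx))
    (ne_of_mem_sphere hx hs0.ne'))
  obtain ⟨n, hn1, hn2, hn3⟩ := (hn.and (hne.and
    (Metric.tendstoUniformlyOn_iff.1 hU (m / 3) (by positivity)))).exists
  set f : ℂ → ℂ := fun z => finiteVal (sphereValue (g n) z) with hf
  have hfne : ∀ z ∈ closedBall z₀ s, f z ≠ 0 := by
    intro z hz h0
    apply hn2 z (hs1 hz)
    rw [← coe_finiteVal (hn1 z (hsρ hz)).1]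
    exact congrArg _ h0
  have hfan : ∀ z ∈ closedBall z₀ s, AnalyticAt ℂ f z := fun z hz =>
    analyticAt_finiteVal (hg n) (hn1 z (hsρ hz)).1
  have hd : DiffContOnCl ℂ f⁻¹ (ball z₀ s) := by
    apply DifferentiableOn.diffContOnCl
    rw [closure_ball z₀ hs0.ne']
    exact fun z hz => ((hfan z hz).inv (hfne z hz)).differentiableAt.differentiableWithinAt
  have hfr : ∀ z ∈ frontier (ball z₀ s), ‖f⁻¹ z‖ ≤ (2 * m / 3)⁻¹ := by
    rw [frontier_ball z₀ hs0.ne']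
    intro z hz
    rw [Pi.inv_apply, norm_inv]
    have h1 := hn3 z (hsρ (sphere_subset_closedBall hz))
    have h2 : m ≤ ‖finiteVal (φ z)‖ := hmin hz
    rw [dist_eq_norm] at h1
    have h3 := norm_sub_norm_le (finiteVal (φ z)) (f z)
    apply inv_anti₀ (by positivity)
    linarith
  have h1 := Complex.norm_le_of_forall_mem_frontier_norm_le isBounded_ball hd hfr
    (subset_closure (mem_ball_self hs0))
  rw [Pi.inv_apply, norm_inv] at h1
  have h2 := hn3 z₀ (mem_closedBall_self hρ.le)
  have h3 : finiteVal (φ z₀) = 0 := by rw [hz, finiteVal_coe]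
  rw [dist_eq_norm, h3, zero_sub, norm_neg] at h2
  have h4 : 0 < ‖f z₀‖ := norm_pos_iff.2 (hfne z₀ (mem_closedBall_self hs0.le))
  have h5 := (inv_le_inv₀ h4 (by positivity)).1 h1
  have h6 : ‖f z₀‖ < m / 3 := h2
  linarith

/-- If the zeros of the `g n` leave every compact set, a nonconstant limit has no zeros. -/
lemma limit_ne_zero (hg : ∀ n, Meromorphic (g n))
    (hnt : ∀ n z, meromorphicOrderAt (g n) z ≠ ⊤)
    (h : SphericallyConverges (fun n => sphereValue (g n)) φ)
    (hφ : ¬ ∃ c : OnePoint ℂ, ∀ z, φ z = c)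
    (hne : ∀ R : ℝ, ∀ᶠ n in atTop, ∀ z ∈ closedBall 0 R,
      sphereValue (g n) z ≠ ((0 : ℂ) : OnePoint ℂ)) (z : ℂ) : φ z ≠ ((0 : ℂ) : OnePoint ℂ) := by
  intro hz
  refine hφ ⟨_, limit_eq_of_eventually hg hnt h (limit_eventually_eq_zero hg h hz ?_)⟩
  filter_upwards [hne (‖z‖ + 1)] with n hn w hw
  apply hn
  rw [mem_closedBall_zero_iff]
  rw [mem_closedBall, dist_eq_norm] at hw
  linarith [norm_sub_norm_le w z]

/-- A nonconstant limit without zeros comes arbitrarily close to `0`: otherwise its reciprocal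
would be a bounded entire function. -/
lemma exists_norm_lt_of_limit_ne_zero (hg : ∀ n, Meromorphic (g n))
    (hnt : ∀ n z, meromorphicOrderAt (g n) z ≠ ⊤)
    (h : SphericallyConverges (fun n => sphereValue (g n)) φ)
    (hφ : ¬ ∃ c : OnePoint ℂ, ∀ z, φ z = c)
    (hne : ∀ z, φ z ≠ ((0 : ℂ) : OnePoint ℂ)) {ε : ℝ} (hε : 0 < ε) :
    ∃ z, φ z ≠ OnePoint.infty ∧ ‖finiteVal (φ z)‖ < ε := by
  by_contra! hcon
  have hinv := h.inv hg hnt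
  have hfin : ∀ z, sphInv (φ z) ≠ OnePoint.infty := fun z => sphInv_ne_infty_iff.2 (hne z)
  have hd : Differentiable ℂ fun z => finiteVal (sphInv (φ z)) := fun z =>
    (analyticAt_finiteVal_limit (g := fun n => (g n)⁻¹) (fun n => (hg n).inv) hinv
      (hfin z)).differentiableAt
  have hb : Bornology.IsBounded (Set.range fun z => finiteVal (sphInv (φ z))) := by
    rw [isBounded_iff_forall_norm_le]
    refine ⟨ε⁻¹, ?_⟩
    rintro _ ⟨z, rfl⟩
    dsimp only
    rcases eq_or_ne (φ z) OnePoint.infty with hz | hz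
    · simp [hz, hε.le]
    · have h1 := hcon z hz
      have h2 : finiteVal (φ z) ≠ 0 := by
        intro h0
        rw [h0, norm_zero] at h1
        linarith
      rw [← coe_finiteVal hz, sphInv_coe h2, finiteVal_coe, norm_inv]
      exact inv_anti₀ hε h1
  apply hφ
  refine ⟨φ 0, fun z => ?_⟩
  have := hd.apply_eq_apply_of_bounded hb z 0
  rw [← sphInv_sphInv (φ z), ← sphInv_sphInv (φ 0), ← coe_finiteVal (hfin z), this,
    coe_finiteVal (hfin 0)]

end

/-! ### Counting solutions near a point -/

section

open Metric

variable {g : ℕ → ℂ → ℂ} {φ : ℂ → OnePoint ℂ}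

/-- The multiplicity of `z` as a zero of `f`; it is `0` at all other points, poles included, and,
by convention, where `f` vanishes identically nearby. -/
def zeroMult (f : ℂ → ℂ) (z : ℂ) : ℤ := (meromorphicOrderAt f z).untop₀⁺

lemma zeroMult_nonneg (f : ℂ → ℂ) (z : ℂ) : 0 ≤ zeroMult f z := posPart_nonneg _

lemma zeroMult_congr {f₁ f₂ : ℂ → ℂ} {z : ℂ} (h : f₁ =ᶠ[𝓝[≠] z] f₂) :
    zeroMult f₁ z = zeroMult f₂ z := by
  rw [zeroMult, meromorphicOrderAt_congr h, zeroMult]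

lemma zeroMult_eq_zero {f : ℂ → ℂ} {z : ℂ} (h : ¬ 0 < meromorphicOrderAt f z) :
    zeroMult f z = 0 := by
  rw [zeroMult, posPart_eq_zero]
  rw [not_lt] at h
  lift meromorphicOrderAt f z to ℤ using ne_top_of_le_ne_top WithTop.zero_ne_top h with n
  exact_mod_cast h

/-- Jensen's bound for the number of zeros, with multiplicity, in the disc of half the radius. -/
lemma sum_zeroMult_mul_log_two_le {f : ℂ → ℂ} {c : ℂ} {R M : ℝ} (hR : 0 < R) (hM1 : 1 ≤ M)
    (hf : AnalyticOnNhd ℂ f (closedBall c R)) (hM : ∀ z ∈ closedBall c R, ‖f z‖ ≤ M)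
    (h0 : f c ≠ 0) (T : Finset ℂ) (hT : (T : Set ℂ) ⊆ closedBall c (R / 2)) :
    (∑ z ∈ T, (zeroMult f z : ℝ)) * Real.log 2 ≤ Real.log M - Real.log ‖f c‖ := by
  have hR' : |R| = R := abs_of_pos hR
  have hmer : MeromorphicOn f (closedBall c |R|) := by
    rw [hR']; exact hf.meromorphicOn
  have hJ := hmer.circleAverage_log_norm hR.ne'
  rw [hR'] at hJ hmer
  set D := MeromorphicOn.divisor f (closedBall c R) with hD
  have hDnn : ∀ u, 0 ≤ D u := fun u => (MeromorphicOn.AnalyticOnNhd.divisor_nonneg hf) u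
  have hDz : ∀ u ∈ closedBall c R, D u = zeroMult f u := by
    intro u hu
    rw [zeroMult, hD, MeromorphicOn.divisor_apply hmer hu, eq_comm, posPart_eq_self]
    have := hDnn u
    rwa [hD, MeromorphicOn.divisor_apply hmer hu] at this
  have hcmem : c ∈ closedBall c R := mem_closedBall_self hR.le
  have hDc : D c = 0 := by
    rw [hD, MeromorphicOn.divisor_apply hmer hcmem, (hf c hcmem).meromorphicOrderAt_eq,
      (hf c hcmem).analyticOrderAt_eq_zero.2 h0]
    simp
  have htr : meromorphicTrailingCoeffAt f c = f c :=
    (hf c hcmem).meromorphicTrailingCoeffAt_of_ne_zero h0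
  rw [hDc, htr] at hJ
  have hav : Real.circleAverage (fun z => Real.log ‖f z‖) c R ≤ Real.log M := by
    apply Real.circleAverage_mono_on_of_le_circle
    · exact MeromorphicOn.circleIntegrable_log_norm_of_nonneg
        (fun z hz => hmer z (sphere_subset_closedBall hz)) hR.le
    · intro z hz
      rw [hR'] at hz
      rcases eq_or_ne (f z) 0 with h | h
      · rw [h, norm_zero, Real.log_zero]
        exact Real.log_nonneg hM1
      · exact Real.log_le_log (norm_pos_iff.2 h) (hM z (sphere_subset_closedBall hz))
  rw [hJ] at hav
  have hfin : D.support.Finite := D.finiteSupport (isCompact_closedBall c R)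
  have hterm : ∀ u, 0 ≤ (D u : ℝ) * Real.log (R * ‖c - u‖⁻¹) := by
    intro u
    by_cases hu : u ∈ closedBall c R
    · refine mul_nonneg (by exact_mod_cast hDnn u) ?_
      rcases eq_or_ne u c with rfl | huc
      · simp
      · apply Real.log_nonneg
        have : 0 < ‖c - u‖ := norm_pos_iff.2 (sub_ne_zero.2 huc.symm)
        rw [mem_closedBall, dist_comm, dist_eq_norm] at hu
        rw [← div_eq_mul_inv, one_le_div this]
        exact hu
    · rw [D.apply_eq_zero_of_notMem hu]
      simp
  have hsum : (∑ z ∈ T, (zeroMult f z : ℝ)) * Real.log 2 ≤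
      ∑ᶠ u, (D u : ℝ) * Real.log (R * ‖c - u‖⁻¹) := by
    classical
    rw [finsum_eq_sum_of_support_subset (s := hfin.toFinset ∪ T)]
    · rw [Finset.sum_mul]
      refine (Finset.sum_le_sum fun u hu => ?_).trans
        (Finset.sum_le_sum_of_subset_of_nonneg Finset.subset_union_right fun u _ _ => hterm u)
      have huR := hT hu
      have huR' : u ∈ closedBall c R := closedBall_subset_closedBall (by linarith) huR
      rw [← hDz u huR']
      rcases eq_or_ne u c with rfl | huc
      · simp [hDc]
      · refine mul_le_mul_of_nonneg_left ?_ (by exact_mod_cast hDnn u)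
        apply Real.log_le_log two_pos
        have : 0 < ‖c - u‖ := norm_pos_iff.2 (sub_ne_zero.2 huc.symm)
        rw [mem_closedBall, dist_comm, dist_eq_norm] at huR
        rw [← div_eq_mul_inv, le_div_iff₀ this]
        linarith
    · intro u hu
      simp only [Function.mem_support] at hu
      simp only [Finset.coe_union, Set.Finite.coe_toFinset, Set.mem_union, Function.mem_support]
      left
      intro h
      simp [h] at hu
  push_cast at hav
  linarith

/-- If `g n` converges spherically to a nonconstant limit, then for infinitely many `n` the number
of solutions of `g n = a n`, for targets `a n` in the unit disc, is bounded near any given point. -/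
lemma exists_sum_zeroMult_le_of_limit (hg : ∀ n, Meromorphic (g n))
    (hnt : ∀ n z, meromorphicOrderAt (g n) z ≠ ⊤)
    (h : SphericallyConverges (fun n => sphereValue (g n)) φ)
    (hφ : ¬ ∃ c : OnePoint ℂ, ∀ z, φ z = c) (a : ℕ → ℂ) (ha : ∀ n, ‖a n‖ ≤ 1) (z₀ : ℂ) :
    ∃ δ > 0, ∃ N : ℝ, ∃ᶠ n in atTop, ∀ T : Finset ℂ, (T : Set ℂ) ⊆ ball z₀ δ →
      ∑ z ∈ T, (zeroMult (fun w => g n w - a n) z : ℝ) ≤ N := by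
  rcases eq_or_ne (φ z₀) OnePoint.infty with hz | hz
  · -- Near a pole of the limit, `g n` is too close to `∞` to attain a value of modulus at most `1`.
    have hc := h.continuous_sphV fun n => continuous_sphereValue (hg n)
    have hz' : sphV (φ z₀) < 1 / 4 := by rw [hz]; norm_num
    obtain ⟨ρ, hρ, hball⟩ := Metric.nhds_basis_closedBall.eventually_iff.1
      (hc.continuousAt.eventually_lt_const hz')
    have hV := Metric.tendstoUniformlyOn_iff.1
      (h.tendstoUniformlyOn_sphV (isCompact_closedBall z₀ ρ))
    refine ⟨ρ, hρ, 0, Eventually.frequently ?_⟩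
    filter_upwards [hV (1 / 4) (by norm_num)] with n hn T hT
    apply le_of_eq
    refine Finset.sum_eq_zero fun z hzT => ?_
    have hzb := ball_subset_closedBall (hT hzT)
    have h1 := hn z hzb
    have h2 : sphV (φ z) < 1 / 4 := hball hzb
    rw [Int.cast_eq_zero]
    apply zeroMult_eq_zero
    intro h3
    have h4 : Tendsto (fun w => g n w - a n) (𝓝[≠] z) (𝓝 0) :=
      tendsto_zero_of_meromorphicOrderAt_pos h3
    have h5 : Tendsto (g n) (𝓝[≠] z) (𝓝 (a n)) := by simpa using h4.add_const (a n)
    rw [sphereValue_eq_coe h5, sphV_coe, Real.dist_eq, abs_lt] at h1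
    have h6 : (1 : ℝ) / 2 ≤ 1 / (1 + ‖a n‖ ^ 2) := by
      apply one_div_le_one_div_of_le (by positivity)
      nlinarith [ha n, norm_nonneg (a n)]
    linarith
  · obtain ⟨a₀, -, s, hs, hsa⟩ := (isCompact_closedBall (0 : ℂ) 1).tendsto_subseq
      (x := a) fun n => mem_closedBall_zero_iff.2 (ha n)
    obtain ⟨ρ, hρ, M, hM0, hn, -, hU⟩ := exists_closedBall_tendstoUniformlyOn hg h hz
    have hfr : ∃ᶠ z in 𝓝 z₀, finiteVal (φ z) ≠ a₀ := by
      intro hcon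
      simp only [not_not] at hcon
      exact hφ ⟨_, limit_eq_of_eventually hg hnt h (limit_eventually_eq_coe hg h hz hcon)⟩
    -- Jensen's bound is used around a point `z₁` near `z₀` where the limit is not the limit target.
    obtain ⟨z₁, hz₁, hz₁b⟩ :=
      (hfr.and_eventually (ball_mem_nhds z₀ (show 0 < ρ / 8 by positivity))).exists
    have hsub : closedBall z₁ (ρ / 2) ⊆ closedBall z₀ ρ :=
      closedBall_subset_closedBall' (by linarith)
    have hlim : Tendsto (fun n => ‖finiteVal (sphereValue (g (s n)) z₁) - a (s n)‖) atTop
        (𝓝 ‖finiteVal (φ z₁) - a₀‖) :=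
      (((hU.tendsto_at (hsub (mem_closedBall_self (by positivity)))).comp
        hs.tendsto_atTop).sub hsa).norm
    have hpos : 0 < ‖finiteVal (φ z₁) - a₀‖ := norm_pos_iff.2 (sub_ne_zero.2 hz₁)
    obtain ⟨m, hm0, hm1⟩ := exists_between hpos
    refine ⟨ρ / 8, by positivity, (Real.log (M + 1) - Real.log m) / Real.log 2, ?_⟩
    refine hs.tendsto_atTop.frequently (Eventually.frequently ?_)
    filter_upwards [hs.tendsto_atTop.eventually hn, hlim.eventually_const_lt hm1]
      with n hn1 hn2 T hT
    set f : ℂ → ℂ := fun w => finiteVal (sphereValue (g (s n)) w) - a (s n) with hf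
    have hfc : ∀ z, zeroMult (fun w => g (s n) w - a (s n)) z = zeroMult f z := by
      intro z
      apply zeroMult_congr
      filter_upwards [eventuallyEq_finiteVal (hg (s n) z)] with w hw
      rw [hw]
    rw [le_div_iff₀ (Real.log_pos one_lt_two)]
    simp only [hfc]
    have h1 : f z₁ ≠ 0 := norm_pos_iff.1 (hm0.trans hn2)
    refine (sum_zeroMult_mul_log_two_le (R := ρ / 2) (M := M + 1) (c := z₁) (by positivity)
      (by linarith) ?_ ?_ h1 T ?_).trans ?_
    · intro z hz
      exact (analyticAt_finiteVal (hg _) (hn1 z (hsub hz)).1).sub analyticAt_const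
    · intro z hz
      exact (norm_sub_le _ _).trans (add_le_add (hn1 z (hsub hz)).2 (ha _))
    · intro z hzT
      have := hT hzT
      rw [mem_ball] at this
      rw [mem_closedBall]
      linarith [dist_triangle z z₀ z₁, dist_comm z₁ z₀]
    · have := Real.log_le_log hm0 hn2.le
      linarith

end

/-! ### Local distribution of zeros of generalised Yosida functions -/

section

open Metric

variable {α β : ℝ} {f : ℂ → ℂ}

/-- Powers of comparable numbers are comparable. -/
lemma rpow_le_two_rpow_abs_mul {x y : ℝ} (γ : ℝ) (hx : 0 < x) (h1 : x / 2 ≤ y) (h2 : y ≤ 2 * x) :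
    y ^ γ ≤ 2 ^ |γ| * x ^ γ := by
  have hy : 0 < y := lt_of_lt_of_le (by positivity) h1
  rcases le_total 0 γ with hγ | hγ
  · rw [abs_of_nonneg hγ, ← Real.mul_rpow two_pos.le hx.le]
    exact Real.rpow_le_rpow hy.le h2 hγ
  · rw [abs_of_nonpos hγ]
    calc y ^ γ ≤ (x / 2) ^ γ := Real.rpow_le_rpow_of_nonpos (by positivity) h1 hγ
      _ = 2 ^ (-γ) * x ^ γ := by
        rw [Real.div_rpow hx.le two_pos.le, Real.rpow_neg two_pos.le, div_eq_mul_inv, mul_comm]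

lemma norm_cpow_neg_ofReal (h : ℂ) (γ : ℝ) : ‖h ^ (-(γ : ℂ))‖ = ‖h‖ ^ (-γ) := by
  rw [← Complex.ofReal_neg, Complex.norm_cpow_real]

lemma cpow_neg_ofReal_ne_zero {h : ℂ} (hh : h ≠ 0) (γ : ℝ) : h ^ (-(γ : ℂ)) ≠ 0 := by
  simp [Complex.cpow_eq_zero_iff, hh]

lemma meromorphic_rescale (hf : Meromorphic f) (h : ℂ) : Meromorphic (rescale α β f h) := by
  intro z
  have h1 : AnalyticAt ℂ (fun z : ℂ => h + h ^ (-(β : ℂ)) * z) z := by fun_prop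
  exact (MeromorphicAt.const _ z).mul ((hf _).comp_analyticAt h1)

lemma meromorphicOrderAt_rescale_sub {h : ℂ} (hh : h ≠ 0) (a z : ℂ) :
    meromorphicOrderAt (fun w => rescale α β f h w - h ^ (-(α : ℂ)) * a) z =
      meromorphicOrderAt (fun w => f w - a) (h + h ^ (-(β : ℂ)) * z) := by
  have h1 : AnalyticAt ℂ (fun z : ℂ => h + h ^ (-(β : ℂ)) * z) z := by fun_prop
  have h2 : deriv (fun z : ℂ => h + h ^ (-(β : ℂ)) * z) z ≠ 0 := by
    have : HasDerivAt (fun z : ℂ => h + h ^ (-(β : ℂ)) * z) (h ^ (-(β : ℂ)) * 1) z :=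
      ((hasDerivAt_id z).const_mul _).const_add _
    rw [this.deriv, mul_one]
    exact cpow_neg_ofReal_ne_zero hh β
  rw [← meromorphicOrderAt_comp_of_deriv_ne_zero (f := fun w => f w - a) h1 h2,
    ← meromorphicOrderAt_mul_of_ne_zero (g := fun _ => h ^ (-(α : ℂ)))
      (f := (fun w => f w - a) ∘ _) analyticAt_const (cpow_neg_ofReal_ne_zero hh α)]
  congr 1 with w
  simp only [rescale, Pi.mul_apply, Function.comp_apply, mul_sub]

lemma meromorphicOrderAt_rescale {h : ℂ} (hh : h ≠ 0) (z : ℂ) :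
    meromorphicOrderAt (rescale α β f h) z = meromorphicOrderAt f (h + h ^ (-(β : ℂ)) * z) := by
  simpa using meromorphicOrderAt_rescale_sub (α := α) (β := β) (f := f) hh 0 z

lemma sphereValue_rescale_eq_zero_iff (hf : Meromorphic f) {h : ℂ} (hh : h ≠ 0) (z : ℂ) :
    sphereValue (rescale α β f h) z = ((0 : ℂ) : OnePoint ℂ) ↔
      sphereValue f (h + h ^ (-(β : ℂ)) * z) = ((0 : ℂ) : OnePoint ℂ) := by
  rw [sphereValue_eq_zero_iff (meromorphic_rescale hf h z), meromorphicOrderAt_rescale hh,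
    sphereValue_eq_zero_iff (hf _)]

lemma sphereValue_rescale_eq_infty_iff (hf : Meromorphic f) {h : ℂ} (hh : h ≠ 0) (z : ℂ) :
    sphereValue (rescale α β f h) z = OnePoint.infty ↔
      sphereValue f (h + h ^ (-(β : ℂ)) * z) = OnePoint.infty := by
  rw [sphereValue_eq_infty_iff (meromorphic_rescale hf h z), meromorphicOrderAt_rescale hh,
    sphereValue_eq_infty_iff (hf _)]

lemma finiteVal_sphereValue_rescale (hf : Meromorphic f) {h : ℂ} (hh : h ≠ 0) (z : ℂ) :
    finiteVal (sphereValue (rescale α β f h) z) =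
      h ^ (-(α : ℂ)) * finiteVal (sphereValue f (h + h ^ (-(β : ℂ)) * z)) := by
  by_cases hinf : sphereValue f (h + h ^ (-(β : ℂ)) * z) = OnePoint.infty
  · rw [(sphereValue_rescale_eq_infty_iff hf hh z).2 hinf, hinf]
    simp
  have h1 : Tendsto (fun z : ℂ => h + h ^ (-(β : ℂ)) * z) (𝓝[≠] z)
      (𝓝[≠] (h + h ^ (-(β : ℂ)) * z)) := by
    apply tendsto_nhdsWithin_of_tendsto_nhds_of_eventually_within
    · exact (Continuous.tendsto (by fun_prop) z).mono_left nhdsWithin_le_nhds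
    · filter_upwards [self_mem_nhdsWithin] with w hw
      simp only [Set.mem_compl_iff, Set.mem_singleton_iff, add_right_inj]
      intro h2
      exact hw (mul_left_cancel₀ (cpow_neg_ofReal_ne_zero hh β) h2)
  have h2 := ((tendsto_finiteVal_sphereValue (hf _) hinf).comp h1).const_mul (h ^ (-(α : ℂ)))
  rw [show sphereValue (rescale α β f h) z = _ from sphereValue_eq_coe h2, finiteVal_coe]

lemma rescale_inv (h : ℂ) : rescale (-α) β f⁻¹ h = (rescale α β f h)⁻¹ := by
  ext z
  simp only [rescale, Pi.inv_apply, mul_inv, Complex.ofReal_neg]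
  rw [Complex.cpow_neg h (-(α : ℂ))]

namespace IsGeneralisedYosida

lemma sphereValue_not_const (hf : IsGeneralisedYosida α β f) :
    ¬ ∃ c : OnePoint ℂ, ∀ z, sphereValue f z = c := by
  rintro ⟨c, hc⟩
  have h1 : ∀ z, ∀ᶠ w in 𝓝[≠] z, (f w : OnePoint ℂ) = c := fun z => by
    filter_upwards [eventually_sphereValue_eq (hf.meromorphic z)] with w hw
    rw [← hw, hc]
  induction c using OnePoint.rec with
  | infty =>
    obtain ⟨w, hw⟩ := (h1 0).exists
    exact OnePoint.coe_ne_infty _ hw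
  | coe c =>
    refine hf.transcendental ⟨Polynomial.C c, 1, one_ne_zero, ?_⟩
    rw [EventuallyEq, Filter.Eventually, mem_codiscrete]
    intro z
    rw [disjoint_principal_right, compl_compl]
    exact (h1 z).mono fun w hw => by simpa using hw

lemma meromorphicOrderAt_ne_top (hf : IsGeneralisedYosida α β f) (z : ℂ) :
    meromorphicOrderAt f z ≠ ⊤ := by
  intro h
  apply hf.sphereValue_not_const
  refine ⟨((0 : ℂ) : OnePoint ℂ), fun w => ?_⟩
  rw [sphereValue_eq_zero_iff (hf.meromorphic w)]
  by_contra hw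
  have hw' : meromorphicOrderAt f w ≠ ⊤ := fun h' => hw (by rw [h']; exact WithTop.top_pos)
  exact (MeromorphicOn.meromorphicOrderAt_ne_top_of_isPreconnected (U := Set.univ)
    (fun x _ => hf.meromorphic x) isPreconnected_univ (Set.mem_univ w) (Set.mem_univ z) hw') h

lemma meromorphicOrderAt_rescale_ne_top (hf : IsGeneralisedYosida α β f) {h : ℂ} (hh : 1 ≤ ‖h‖)
    (z : ℂ) : meromorphicOrderAt (rescale α β f h) z ≠ ⊤ := by
  rw [meromorphicOrderAt_rescale (norm_pos_iff.1 (by linarith))]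
  exact hf.meromorphicOrderAt_ne_top _

/-- The reciprocal of a Yosida function with exponent `α` is one with exponent `-α`. -/
lemma inv (hf : IsGeneralisedYosida α β f) : IsGeneralisedYosida (-α) β f⁻¹ where
  meromorphic := hf.meromorphic.inv
  transcendental := by
    rintro ⟨p, q, hq, hpq⟩
    by_cases hp : p = 0
    · refine hf.transcendental ⟨0, 1, one_ne_zero, ?_⟩
      filter_upwards [hpq] with z hz
      simpa [hp] using hz
    · refine hf.transcendental ⟨q, p, hp, ?_⟩
      filter_upwards [hpq] with z hz
      rw [Pi.inv_apply] at hz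
      rw [← inv_inv (f z), hz, inv_div]
  normal := by
    intro h hh
    obtain ⟨s, φ, hs, hφ⟩ := hf.normal h hh
    refine ⟨s, fun z => sphInv (φ z), hs, ?_⟩
    simp only [rescale_inv]
    exact hφ.inv (g := fun n => rescale α β f (h (s n)))
      (fun n => meromorphic_rescale hf.meromorphic _)
      (fun n => hf.meromorphicOrderAt_rescale_ne_top (hh _))
  limit_not_constant := by
    rintro h φ hh hlim hφ ⟨c, hc⟩
    refine hf.limit_not_constant h (fun z => sphInv (φ z)) hh hlim ?_ ⟨sphInv c, fun z => by rw [hc]⟩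
    simp only [rescale_inv] at hφ
    have := hφ.inv (g := fun n => (rescale α β f (h n))⁻¹)
      (fun n => (meromorphic_rescale hf.meromorphic _).inv)
      (fun n z => by
        rw [meromorphicOrderAt_inv]
        have := hf.meromorphicOrderAt_rescale_ne_top (hh n) z
        lift meromorphicOrderAt (rescale α β f (h n)) z to ℤ using this with k
        exact WithTop.coe_ne_top)
    simpa only [inv_inv] using this

/-- Uniform local bound for the number of solutions of `f = a` in discs of radius comparable to
`|h|^{-β}`, for those targets `a` which the rescaling at `h` moves into the unit disc. -/
lemma exists_sum_zeroMult_le (hf : IsGeneralisedYosida α β f) :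
    ∃ δ > 0, ∃ N h₀ : ℝ, ∀ h : ℂ, h₀ ≤ ‖h‖ → ∀ a : ℂ, ‖h‖ ^ (-α) * ‖a‖ ≤ 1 →
      ∀ T : Finset ℂ, (T : Set ℂ) ⊆ ball h (δ * ‖h‖ ^ (-β)) →
        ∑ z ∈ T, (zeroMult (fun w => f w - a) z : ℝ) ≤ N := by
  classical
  by_contra! hcon
  have hcon' := fun n : ℕ => hcon (1 / ((n : ℝ) + 1)) (by positivity) n (n + 1)
  choose h hh a ha T hT hTN using hcon'
  have hh1 : ∀ n, 1 ≤ ‖h n‖ := fun n => le_trans (by simp) (hh n)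
  obtain ⟨s, φ, hs, hφ⟩ := hf.normal h hh1
  have hlim : Tendsto (fun n => ‖h (s n)‖) atTop atTop :=
    (tendsto_atTop_mono (fun n => by linarith [hh n]) tendsto_natCast_atTop_atTop :
      Tendsto (fun n => ‖h n‖) atTop atTop).comp hs.tendsto_atTop
  obtain ⟨δ, hδ, N, hN⟩ := exists_sum_zeroMult_le_of_limit
    (g := fun n => rescale α β f (h (s n)))
    (fun n => meromorphic_rescale hf.meromorphic _)
    (fun n => hf.meromorphicOrderAt_rescale_ne_top (hh1 _)) hφ
    (hf.limit_not_constant _ φ (fun n => hh1 (s n)) hlim hφ)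
    (fun n => h (s n) ^ (-(α : ℂ)) * a (s n))
    (fun n => by rw [norm_mul, norm_cpow_neg_ofReal]; exact ha _) 0
  have hev : ∀ᶠ n : ℕ in atTop, 1 / ((n : ℝ) + 1) < δ ∧ N ≤ n :=
    (tendsto_one_div_add_atTop_nhds_zero_nat.eventually_lt_const hδ).and
      (tendsto_natCast_atTop_atTop.eventually_ge_atTop N)
  obtain ⟨n, hn, hnδ, hnN⟩ := (hN.and_eventually (hs.tendsto_atTop.eventually hev)).exists
  set H := h (s n) with hH
  have hH0 : H ≠ 0 := norm_pos_iff.1 (zero_lt_one.trans_le (hh1 _))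
  set k : ℂ := H ^ (-(β : ℂ)) with hk
  have hk0 : k ≠ 0 := cpow_neg_ofReal_ne_zero hH0 β
  have hkn : ‖k‖ = ‖H‖ ^ (-β) := norm_cpow_neg_ofReal _ _
  have hk_pos : 0 < ‖k‖ := norm_pos_iff.2 hk0
  have hinv : ∀ z, H + k * ((z - H) / k) = z := fun z => by field_simp; ring
  have hinj : Function.Injective fun z : ℂ => (z - H) / k := fun x y hxy => by
    rw [← hinv x, ← hinv y]
    exact congrArg (fun t => H + k * t) hxy
  have h1 := hn ((T (s n)).image fun z => (z - H) / k) (by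
    intro w hw
    simp only [Finset.coe_image, Set.mem_image, SetLike.mem_coe] at hw
    obtain ⟨z, hz, rfl⟩ := hw
    have h2 := hT _ hz
    rw [mem_ball, dist_eq_norm, ← hH, ← hkn] at h2
    rw [mem_ball_zero_iff, norm_div, div_lt_iff₀ hk_pos]
    exact h2.trans (by gcongr))
  rw [Finset.sum_image hinj.injOn] at h1
  have h2 : ∀ z, zeroMult (fun w => rescale α β f H w - H ^ (-(α : ℂ)) * a (s n))
      ((z - H) / k) = zeroMult (fun w => f w - a (s n)) z := by
    intro z
    rw [zeroMult, meromorphicOrderAt_rescale_sub hH0, ← hk, hinv, zeroMult]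
  simp only [h2] at h1
  exact absurd (hTN (s n)) (not_lt.2 (h1.trans hnN))

/-- The number of solutions of `f = a` in a fixed disc is bounded uniformly in `|a| ≤ 1`. -/
lemma exists_sum_zeroMult_le_closedBall (hf : IsGeneralisedYosida α β f) (R : ℝ) :
    ∃ N : ℝ, ∀ a : ℂ, ‖a‖ ≤ 1 → ∀ T : Finset ℂ, (T : Set ℂ) ⊆ closedBall 0 R →
        ∑ z ∈ T, (zeroMult (fun w => f w - a) z : ℝ) ≤ N := by
  classical
  refine (isCompact_closedBall (0 : ℂ) R).induction_on
    (p := fun S => ∃ N : ℝ, ∀ a : ℂ, ‖a‖ ≤ 1 → ∀ T : Finset ℂ, (T : Set ℂ) ⊆ S →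
        ∑ z ∈ T, (zeroMult (fun w => f w - a) z : ℝ) ≤ N) ?_ ?_ ?_ ?_
  · refine ⟨0, fun a _ T hT => ?_⟩
    rw [Set.subset_empty_iff, Finset.coe_eq_empty] at hT
    simp [hT]
  · rintro S S' hS ⟨N, hN⟩
    exact ⟨N, fun a ha T hT => hN a ha T (hT.trans hS)⟩
  · rintro S S' ⟨N, hN⟩ ⟨N', hN'⟩
    refine ⟨N + N', fun a ha T hT => ?_⟩
    rw [← Finset.sum_filter_add_sum_filter_not T (· ∈ S)]
    refine add_le_add (hN a ha _ fun z hz => ?_) (hN' a ha _ fun z hz => ?_)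
    · simp only [Finset.coe_filter, Set.mem_ofPred_eq] at hz
      exact hz.2
    · simp only [Finset.coe_filter, Set.mem_ofPred_eq] at hz
      exact (hT hz.1).resolve_left hz.2
  · intro z₀ _
    by_contra! hcon
    have hcon' := fun n : ℕ => hcon (ball z₀ (1 / ((n : ℝ) + 1)))
      (mem_nhdsWithin_of_mem_nhds (ball_mem_nhds _ (by positivity))) n
    choose a ha T hT hTN using hcon'
    obtain ⟨δ, hδ, N, hN⟩ := exists_sum_zeroMult_le_of_limit
      (g := fun _ => f) (φ := sphereValue f) (fun _ => hf.meromorphic)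
      (fun _ => hf.meromorphicOrderAt_ne_top)
      (fun K _ ε hε => Eventually.of_forall fun n z _ => by rwa [chordalDist_self])
      hf.sphereValue_not_const a ha z₀
    have hev : ∀ᶠ n : ℕ in atTop, 1 / ((n : ℝ) + 1) < δ ∧ N ≤ n :=
      (tendsto_one_div_add_atTop_nhds_zero_nat.eventually_lt_const hδ).and
        (tendsto_natCast_atTop_atTop.eventually_ge_atTop N)
    obtain ⟨n, hn, hnδ, hnN⟩ := (hN.and_eventually hev).exists
    exact absurd (hTN n) (not_lt.2 ((hn (T n) ((hT n).trans (ball_subset_ball hnδ.le))).trans hnN))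

/-- If `f` has no zeros in discs of radius `R n * |h n|^{-β}` about `h n`, where `h n → ∞` and
`R n → ∞`, then the limit of the functions rescaled at `h n` has no zeros. -/
lemma limit_ne_zero_of_zeroFree (hf : IsGeneralisedYosida α β f) {h : ℕ → ℂ} {R : ℕ → ℝ}
    {φ : ℂ → OnePoint ℂ} (hh : ∀ n, 1 ≤ ‖h n‖) (hlim : Tendsto (fun n => ‖h n‖) atTop atTop)
    (hφ : SphericallyConverges (fun n => sphereValue (rescale α β f (h n))) φ)
    (hR : ∀ n : ℕ, (n : ℝ) < R n)
    (hz : ∀ n, ∀ z ∈ ball (h n) (R n * ‖h n‖ ^ (-β)), sphereValue f z ≠ ((0 : ℂ) : OnePoint ℂ))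
    (z : ℂ) : φ z ≠ ((0 : ℂ) : OnePoint ℂ) := by
  refine limit_ne_zero (g := fun n => rescale α β f (h n))
    (fun n => meromorphic_rescale hf.meromorphic _)
    (fun n => hf.meromorphicOrderAt_rescale_ne_top (hh n)) hφ
    (hf.limit_not_constant _ φ hh hlim hφ) (fun ρ => ?_) z
  filter_upwards [tendsto_natCast_atTop_atTop.eventually_ge_atTop ρ] with n hn w hw
  have hH0 : h n ≠ 0 := norm_pos_iff.1 (zero_lt_one.trans_le (hh n))
  rw [Ne, sphereValue_rescale_eq_zero_iff hf.meromorphic hH0]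
  apply hz
  rw [mem_ball, dist_eq_norm, add_sub_cancel_left, norm_mul, norm_cpow_neg_ofReal, mul_comm]
  have : 0 < ‖h n‖ ^ (-β) := Real.rpow_pos_of_pos (norm_pos_iff.2 hH0) _
  rw [mem_closedBall_zero_iff] at hw
  have := hR n
  gcongr
  linarith

/-- Suppose `f` has zero-free discs of radius `R |h|^{-β}` about far away points `h` for arbitrarily
large `R`. Then their centres may be chosen such that the rescaled functions are small at `0`.
The rescalings at the original centres have a zero-free limit, which is small at some point `c` by
Liouville's theorem; the new centre is the point corresponding to `c`. -/
lemma exists_recentred_small (hβ : -1 < β) (hf : IsGeneralisedYosida α β f)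
    (hcon : ∀ R > 0, ∀ h₀ : ℝ, ∃ h : ℂ, h₀ ≤ ‖h‖ ∧
      ∀ z ∈ ball h (R * ‖h‖ ^ (-β)), sphereValue f z ≠ ((0 : ℂ) : OnePoint ℂ))
    {ε R : ℝ} (hε : 0 < ε) (hR : 0 < R) (h₀ : ℝ) :
    ∃ h : ℂ, h₀ ≤ ‖h‖ ∧ 1 ≤ ‖h‖ ∧
      (∀ z ∈ ball h (R * ‖h‖ ^ (-β)), sphereValue f z ≠ ((0 : ℂ) : OnePoint ℂ)) ∧
      sphereValue (rescale α β f h) 0 ≠ OnePoint.infty ∧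
      ‖finiteVal (sphereValue (rescale α β f h) 0)‖ < ε := by
  have hcon' := fun n : ℕ => hcon ((n : ℝ) + 1) (by positivity) (n + 1)
  choose h hh hz using hcon'
  have hh1 : ∀ n, 1 ≤ ‖h n‖ := fun n => le_trans (by simp) (hh n)
  obtain ⟨s, φ, hs, hφ⟩ := hf.normal h hh1
  have hlim : Tendsto (fun n => ‖h (s n)‖) atTop atTop :=
    (tendsto_atTop_mono (fun n => by linarith [hh n]) tendsto_natCast_atTop_atTop :
      Tendsto (fun n => ‖h n‖) atTop atTop).comp hs.tendsto_atTop
  have hmer : ∀ n, Meromorphic (rescale α β f (h (s n))) :=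
    fun n => meromorphic_rescale hf.meromorphic _
  have hnt := fun n => hf.meromorphicOrderAt_rescale_ne_top (hh1 (s n))
  have hnc := hf.limit_not_constant _ φ (fun n => hh1 (s n)) hlim hφ
  have hφ0 := hf.limit_ne_zero_of_zeroFree (fun n => hh1 (s n)) hlim hφ
    (R := fun n => (s n : ℝ) + 1)
    (fun n => by exact_mod_cast Nat.lt_succ_of_le hs.le_apply)
    fun n => hz (s n)
  obtain ⟨c, hc, hcε⟩ := exists_norm_lt_of_limit_ne_zero hmer hnt hφ hnc hφ0
    (show 0 < ε / 2 ^ |(-α)| by positivity)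
  obtain ⟨ρ, hρ, M, -, hfin, -, hU⟩ := exists_closedBall_tendstoUniformlyOn hmer hφ hc
  have hcm : c ∈ closedBall c ρ := mem_closedBall_self hρ.le
  have hsmall := ((hU.tendsto_at hcm).norm).eventually_lt_const hcε
  have hrel : Tendsto (fun n => ‖h (s n)‖ ^ (-(β + 1)) * ‖c‖) atTop (𝓝 0) := by
    simpa using ((tendsto_rpow_neg_atTop (show 0 < β + 1 by linarith)).comp hlim).mul_const ‖c‖
  obtain ⟨n, hn1, hn2, hn3, hn4, hn5⟩ := (hfin.and (hsmall.and
    ((hrel.eventually_le_const (show (0 : ℝ) < 1 / 2 by norm_num)).and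
    ((hlim.eventually_ge_atTop (2 * max h₀ 1)).and
    (tendsto_natCast_atTop_atTop.eventually_ge_atTop (‖c‖ + R * 2 ^ |(-β)|)))))).exists
  set H := h (s n) with hH
  have hHpos : 0 < ‖H‖ := zero_lt_one.trans_le (hh1 _)
  have hH0 : H ≠ 0 := norm_pos_iff.1 hHpos
  set k : ℂ := H ^ (-(β : ℂ)) with hk
  have hkn : ‖k‖ = ‖H‖ ^ (-β) := norm_cpow_neg_ofReal _ _
  have hkc : ‖k * c‖ ≤ ‖H‖ / 2 := by
    have : ‖H‖ ^ (-β) = ‖H‖ ^ (-(β + 1)) * ‖H‖ := by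
      rw [← Real.rpow_add_one hHpos.ne']
      congr 1
      ring
    rw [norm_mul, hkn, this]
    nlinarith
  set H' := H + k * c with hH'
  -- `H'` is the new centre; it is comparable to `H` in modulus since `β > -1`.
  have hlow : ‖H‖ / 2 ≤ ‖H'‖ := by
    have := norm_sub_norm_le H (-(k * c))
    rw [norm_neg, sub_neg_eq_add] at this
    linarith
  have hupp : ‖H'‖ ≤ 2 * ‖H‖ := by
    have := norm_add_le H (k * c)
    linarith
  have hH'1 : max h₀ 1 ≤ ‖H'‖ := by linarith
  have hH'0 : H' ≠ 0 :=
    norm_pos_iff.1 (zero_lt_one.trans_le ((le_max_right _ _).trans hH'1))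
  refine ⟨H', (le_max_left _ _).trans hH'1, (le_max_right _ _).trans hH'1, ?_, ?_, ?_⟩
  · intro z hzb
    apply hz (s n)
    rw [mem_ball, dist_eq_norm] at hzb ⊢
    have h1 : ‖H'‖ ^ (-β) ≤ 2 ^ |(-β)| * ‖H‖ ^ (-β) :=
      rpow_le_two_rpow_abs_mul (-β) hHpos hlow hupp
    have h2 : (n : ℝ) ≤ s n := by exact_mod_cast hs.id_le n
    have h3 : z - H = (z - H') + k * c := by rw [hH']; ring
    have h4 : 0 < ‖H‖ ^ (-β) := Real.rpow_pos_of_pos hHpos _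
    have h5 : R * ‖H'‖ ^ (-β) ≤ R * (2 ^ |(-β)| * ‖H‖ ^ (-β)) := by gcongr
    calc ‖z - H‖ ≤ ‖z - H'‖ + ‖k * c‖ := by rw [h3]; exact norm_add_le _ _
      _ < R * (2 ^ |(-β)| * ‖H‖ ^ (-β)) + ‖c‖ * ‖H‖ ^ (-β) := by
        rw [norm_mul, hkn, mul_comm ‖c‖]
        linarith
      _ = (‖c‖ + R * 2 ^ |(-β)|) * ‖H‖ ^ (-β) := by ring
      _ ≤ (s n + 1) * ‖H‖ ^ (-β) := mul_le_mul_of_nonneg_right (by linarith) h4.le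
  · rw [Ne, sphereValue_rescale_eq_infty_iff hf.meromorphic hH'0, mul_zero, add_zero]
    have := (hn1 c hcm).1
    rwa [Ne, sphereValue_rescale_eq_infty_iff hf.meromorphic hH0] at this
  · rw [finiteVal_sphereValue_rescale hf.meromorphic hH0, norm_mul, norm_cpow_neg_ofReal] at hn2
    rw [finiteVal_sphereValue_rescale hf.meromorphic hH'0, norm_mul, norm_cpow_neg_ofReal,
      mul_zero, add_zero]
    have h1 : ‖H'‖ ^ (-α) ≤ 2 ^ |(-α)| * ‖H‖ ^ (-α) :=
      rpow_le_two_rpow_abs_mul (-α) hHpos hlow hupp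
    rw [lt_div_iff₀ (by positivity)] at hn2
    calc ‖H'‖ ^ (-α) * ‖finiteVal (sphereValue f H')‖
        ≤ 2 ^ |(-α)| * ‖H‖ ^ (-α) * ‖finiteVal (sphereValue f H')‖ := by gcongr
      _ = ‖H‖ ^ (-α) * ‖finiteVal (sphereValue f H')‖ * 2 ^ |(-α)| := by ring
      _ < ε := hn2

/-- Every disc of radius `R |h|^{-β}` about a far away point `h` contains a zero of `f`. Otherwise
there would be a limit of rescaled functions that is zero-free by Hurwitz's theorem, and yet
vanishes at `0` by the choice of the centres in `exists_recentred_small`. -/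
lemma exists_zero (hβ : -1 < β) (hf : IsGeneralisedYosida α β f) :
    ∃ R > 0, ∃ h₀ : ℝ, ∀ h : ℂ, h₀ ≤ ‖h‖ →
      ∃ z ∈ ball h (R * ‖h‖ ^ (-β)), sphereValue f z = ((0 : ℂ) : OnePoint ℂ) := by
  by_contra! hcon
  have hrec := fun n : ℕ => hf.exists_recentred_small hβ hcon
    (show (0 : ℝ) < 1 / ((n : ℝ) + 1) by positivity) (show (0 : ℝ) < (n : ℝ) + 1 by positivity) n
  choose h hh hh1 hz hfin hsmall using hrec
  obtain ⟨s, φ, hs, hφ⟩ := hf.normal h hh1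
  have hlim : Tendsto (fun n => ‖h (s n)‖) atTop atTop :=
    (tendsto_atTop_mono hh tendsto_natCast_atTop_atTop :
      Tendsto (fun n => ‖h n‖) atTop atTop).comp hs.tendsto_atTop
  have hφ0 := hf.limit_ne_zero_of_zeroFree (fun n => hh1 (s n)) hlim hφ
    (R := fun n => (s n : ℝ) + 1)
    (fun n => by exact_mod_cast Nat.lt_succ_of_le hs.le_apply)
    fun n => hz (s n)
  have hV : Tendsto (fun n => sphV (sphereValue (rescale α β f (h (s n))) 0)) atTop
      (𝓝 (sphV (φ 0))) :=
    (hφ.tendstoUniformlyOn_sphV isCompact_singleton).tendsto_at (Set.mem_singleton 0)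
  have hval : Tendsto (fun n => ‖finiteVal (sphereValue (rescale α β f (h (s n))) 0)‖) atTop
      (𝓝 0) :=
    (squeeze_zero (fun _ => norm_nonneg _) (fun n => (hsmall n).le)
      tendsto_one_div_add_atTop_nhds_zero_nat).comp hs.tendsto_atTop
  have hV' : Tendsto (fun n => sphV (sphereValue (rescale α β f (h (s n))) 0)) atTop (𝓝 1) := by
    have h1 : Tendsto (fun n => 1 / (1 + ‖finiteVal (sphereValue (rescale α β f (h (s n))) 0)‖ ^ 2))
        atTop (𝓝 (1 / (1 + 0 ^ 2))) :=
      tendsto_const_nhds.div ((hval.pow 2).const_add 1) (by norm_num)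
    rw [show (1 : ℝ) / (1 + 0 ^ 2) = 1 by norm_num] at h1
    refine h1.congr fun n => ?_
    rw [← sphV_coe, coe_finiteVal (hfin (s n))]
  have h1 : sphV (sphInv (φ 0)) = 0 := by
    rw [sphV_sphInv, tendsto_nhds_unique hV hV', sub_self]
  exact absurd (sphV_pos_iff.2 (sphInv_ne_infty_iff.2 (hφ0 0))) (by rw [h1]; exact lt_irrefl 0)

end IsGeneralisedYosida

end

/-! ### From local to global counts -/

section

open Metric MeasureTheory

variable {β : ℝ}

lemma rpow_mul_rpow_neg_sq {x : ℝ} (hx : 0 < x) (β : ℝ) :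
    x ^ (2 * β + 2) * (x ^ (-β)) ^ 2 = x ^ 2 := by
  rw [← Real.rpow_natCast (x ^ (-β)) 2, ← Real.rpow_mul hx.le, ← Real.rpow_add hx,
    ← Real.rpow_natCast x 2]
  congr 1
  push_cast
  ring

lemma eventually_mul_rpow_neg_le (hβ : -1 < β) (A : ℝ) {c : ℝ} (hc : 0 < c) :
    ∀ᶠ r : ℝ in atTop, A * r ^ (-β) ≤ c * r := by
  have h : Tendsto (fun r : ℝ => A * r ^ (-(β + 1))) atTop (𝓝 0) := by
    simpa using (tendsto_rpow_neg_atTop (show 0 < β + 1 by linarith)).const_mul A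
  filter_upwards [h.eventually_le_const hc, eventually_gt_atTop 0] with r h1 hr
  have h2 : r ^ (-β) = r ^ (-(β + 1)) * r := by
    rw [← Real.rpow_add_one hr.ne']
    congr 1
    ring
  rw [h2, ← mul_assoc]
  exact mul_le_mul_of_nonneg_right h1 hr.le

lemma volume_real_ball (c : ℂ) {r : ℝ} (hr : 0 ≤ r) :
    volume.real (ball c r) = Real.pi * r ^ 2 := by
  rw [Measure.real, Complex.volume_ball]
  simp [ENNReal.toReal_ofReal hr, mul_comm]

lemma integrable_indicator_ball (c : ℂ) (r a : ℝ) :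
    Integrable ((ball c r).indicator fun _ => a) :=
  (integrable_indicator_iff measurableSet_ball).2
    (integrableOn_const (by rw [Complex.volume_ball]; finiteness))

lemma integral_indicator_ball (c : ℂ) {r : ℝ} (hr : 0 ≤ r) (a : ℝ) :
    ∫ h, (ball c r).indicator (fun _ => a) h = Real.pi * r ^ 2 * a := by
  rw [integral_indicator_const _ measurableSet_ball, volume_real_ball c hr, smul_eq_mul]

lemma integral_sum_indicator_ball (T : Finset ℂ) (D : ℂ → ℝ) {ρ : ℝ} (hρ : 0 ≤ ρ) :
    ∫ h, ∑ z ∈ T, (ball z ρ).indicator (fun _ => D z) h = Real.pi * ρ ^ 2 * ∑ z ∈ T, D z := by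
  rw [integral_finsetSum _ fun z _ => integrable_indicator_ball z ρ (D z), Finset.mul_sum]
  exact Finset.sum_congr rfl fun z _ => integral_indicator_ball z hρ _

open Classical in
lemma sum_indicator_ball_eq (T : Finset ℂ) (D : ℂ → ℝ) (ρ : ℝ) (h : ℂ) :
    ∑ z ∈ T, (ball z ρ).indicator (fun _ => D z) h =
      ∑ z ∈ T with z ∈ ball h ρ, D z := by
  rw [Finset.sum_filter]
  refine Finset.sum_congr rfl fun z _ => ?_
  simp only [Set.indicator, mem_ball_comm (x := h)]

/-- If a weight `D` has mass at most `N` in the discs of radius `δ |h|^{-β}`, its mass in the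
annulus `r / 2 ≤ |z| ≤ r` is `O(r^{2β+2})`, with constants that do not depend on `D`. For the proof,
the mass in discs of a fixed radius `ρ` comparable to `r^{-β}` is integrated over their centres. -/
lemma exists_annulus_bound (hβ : -1 < β) {δ : ℝ} (hδ : 0 < δ) (N h₀ : ℝ) :
    ∃ C r₁ : ℝ, 0 ≤ C ∧ 0 < r₁ ∧ ∀ D : ℂ → ℝ,
      (∀ h : ℂ, h₀ ≤ ‖h‖ → ∀ T : Finset ℂ, (T : Set ℂ) ⊆ ball h (δ * ‖h‖ ^ (-β)) →
        ∑ z ∈ T, D z ≤ N) →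
      ∀ r ≥ r₁, ∀ T : Finset ℂ, (∀ z ∈ T, r / 2 ≤ ‖z‖ ∧ ‖z‖ ≤ r) →
        ∑ z ∈ T, D z ≤ C * r ^ (2 * β + 2) := by
  classical
  -- One factor `2 ^ |β|` compares `r` with `|z|`, the other one `|z|` with the centre `|h|`.
  set K : ℝ := 2 ^ |(-β)| * 2 ^ |(-β)| with hK
  have hK0 : 0 < K := by positivity
  obtain ⟨r₀, hr₀⟩ := eventually_atTop.1 (eventually_mul_rpow_neg_le hβ (δ / K)
    (show (0 : ℝ) < 1 / 4 by norm_num))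
  refine ⟨4 * |N| * K ^ 2 / δ ^ 2, max (max r₀ (4 * h₀)) 1, by positivity, by positivity, ?_⟩
  intro D hD r hr T hT
  have hr1 : 0 < r := zero_lt_one.trans_le ((le_max_right _ _).trans hr)
  have hr2 : 4 * h₀ ≤ r := (le_max_right _ _).trans ((le_max_left _ _).trans hr)
  have hr3 := hr₀ r ((le_max_left _ _).trans ((le_max_left _ _).trans hr))
  have hrβ : 0 < r ^ (-β) := Real.rpow_pos_of_pos hr1 _
  set ρ := δ / K * r ^ (-β) with hρ
  have hρ0 : 0 < ρ := by positivity
  have hpt : ∀ h : ℂ, ∑ z ∈ T, (ball z ρ).indicator (fun _ => D z) h ≤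
      (ball (0 : ℂ) (2 * r)).indicator (fun _ => |N|) h := by
    intro h
    rw [sum_indicator_ball_eq]
    rcases Finset.eq_empty_or_nonempty {z ∈ T | z ∈ ball h ρ} with he | ⟨z, hz⟩
    · rw [he, Finset.sum_empty]
      exact Set.indicator_nonneg (fun _ _ => abs_nonneg N) h
    · rw [Finset.mem_filter] at hz
      obtain ⟨hzT, hzh⟩ := hz
      obtain ⟨hz1, hz2⟩ := hT z hzT
      rw [mem_ball, dist_eq_norm] at hzh
      have a1 := norm_sub_norm_le z h
      have a2 := norm_sub_norm_le h z
      rw [norm_sub_rev] at a2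
      have hmem : h ∈ ball (0 : ℂ) (2 * r) := by
        rw [mem_ball_zero_iff]
        linarith
      rw [Set.indicator_of_mem hmem]
      refine (hD h (by linarith) _ fun x hx => ?_).trans (le_abs_self N)
      simp only [Finset.coe_filter, Set.mem_ofPred_eq] at hx
      refine ball_subset_ball ?_ hx.2
      have hh0 : 0 < ‖h‖ := by linarith
      have b1 := rpow_le_two_rpow_abs_mul (x := ‖z‖) (y := r) (-β) (by linarith) (by linarith)
        (by linarith)
      have b2 := rpow_le_two_rpow_abs_mul (x := ‖h‖) (y := ‖z‖) (-β) hh0 (by linarith)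
        (by linarith)
      have b3 : r ^ (-β) ≤ K * ‖h‖ ^ (-β) := by
        rw [hK, mul_assoc]
        exact b1.trans (by gcongr)
      calc ρ ≤ δ / K * (K * ‖h‖ ^ (-β)) := by rw [hρ]; gcongr
        _ = δ * ‖h‖ ^ (-β) := by field_simp
  have hint := integral_mono (integrable_finsetSum _
    fun z _ => integrable_indicator_ball z ρ (D z)) (integrable_indicator_ball 0 (2 * r) |N|) hpt
  rw [integral_sum_indicator_ball T D hρ0.le, integral_indicator_ball 0 (by positivity),
    mul_assoc, mul_assoc, mul_le_mul_iff_right₀ Real.pi_pos] at hint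
  have hfin : (∑ z ∈ T, D z) * (δ ^ 2 / K ^ 2) ≤ 4 * |N| * r ^ (2 * β + 2) := by
    refine le_of_mul_le_mul_right ?_ (show 0 < (r ^ (-β)) ^ 2 by positivity)
    calc (∑ z ∈ T, D z) * (δ ^ 2 / K ^ 2) * (r ^ (-β)) ^ 2 = ρ ^ 2 * ∑ z ∈ T, D z := by
          rw [hρ]; ring
      _ ≤ _ := hint
      _ = 4 * |N| * (r ^ (2 * β + 2) * (r ^ (-β)) ^ 2) := by
        rw [rpow_mul_rpow_neg_sq hr1]; ring
      _ = _ := by ring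
  calc ∑ z ∈ T, D z = (∑ z ∈ T, D z) * (δ ^ 2 / K ^ 2) * (K ^ 2 / δ ^ 2) := by field_simp
    _ ≤ 4 * |N| * r ^ (2 * β + 2) * (K ^ 2 / δ ^ 2) := by gcongr
    _ = _ := by ring

/-- Summation of the bound for annuli over a dyadic decomposition of the disc. -/
lemma exists_disc_bound (hβ : -1 < β) {δ : ℝ} (hδ : 0 < δ) (N h₀ : ℝ) :
    ∃ C r₁ : ℝ, 0 ≤ C ∧ ∀ D : ℂ → ℝ,
      (∀ h : ℂ, h₀ ≤ ‖h‖ → ∀ T : Finset ℂ, (T : Set ℂ) ⊆ ball h (δ * ‖h‖ ^ (-β)) →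
        ∑ z ∈ T, D z ≤ N) →
      ∀ B : ℝ, (∀ T : Finset ℂ, (T : Set ℂ) ⊆ closedBall 0 r₁ → ∑ z ∈ T, D z ≤ B) →
      ∀ r > 0, ∀ T : Finset ℂ, (T : Set ℂ) ⊆ closedBall 0 r →
        ∑ z ∈ T, D z ≤ C * r ^ (2 * β + 2) + B := by
  classical
  obtain ⟨C, r₁, hC, hr₁, hann⟩ := exists_annulus_bound hβ hδ N h₀
  set q : ℝ := 2 ^ (-(2 * β + 2)) with hq
  have hq1 : q < 1 := Real.rpow_lt_one_of_one_lt_of_neg one_lt_two (by linarith)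
  have hM : 0 ≤ C / (1 - q) := div_nonneg hC (by linarith)
  refine ⟨C / (1 - q), r₁, hM, fun D hD B hB => ?_⟩
  have key : ∀ n : ℕ, ∀ r > 0, r ≤ 2 ^ n * r₁ → ∀ T : Finset ℂ, (T : Set ℂ) ⊆ closedBall 0 r →
        ∑ z ∈ T, D z ≤ C / (1 - q) * r ^ (2 * β + 2) + B := by
    intro n
    induction n with
    | zero =>
      intro r hr hle T hT
      rw [pow_zero, one_mul] at hle
      have := hB T (hT.trans (closedBall_subset_closedBall hle))
      have h2 : 0 ≤ C / (1 - q) * r ^ (2 * β + 2) := by positivity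
      linarith
    | succ n ih =>
      intro r hr hle T hT
      rcases le_total r r₁ with hrr | hrr
      · have := hB T (hT.trans (closedBall_subset_closedBall hrr))
        have h2 : 0 ≤ C / (1 - q) * r ^ (2 * β + 2) := by positivity
        linarith
      rw [← Finset.sum_filter_add_sum_filter_not T (fun z => ‖z‖ ≤ r / 2)]
      have h1 := ih (r / 2) (by positivity) (by rw [pow_succ] at hle; linarith)
        {z ∈ T | ‖z‖ ≤ r / 2} (fun z hz => by
          simp only [Finset.coe_filter, Set.mem_ofPred_eq] at hz
          exact mem_closedBall_zero_iff.2 hz.2)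
      have h2 := hann D hD r hrr {z ∈ T | ¬ ‖z‖ ≤ r / 2} (fun z hz => by
        rw [Finset.mem_filter, not_le] at hz
        exact ⟨hz.2.le, mem_closedBall_zero_iff.1 (hT hz.1)⟩)
      have h3 : (r / 2) ^ (2 * β + 2) = q * r ^ (2 * β + 2) := by
        rw [Real.div_rpow hr.le two_pos.le, hq, Real.rpow_neg two_pos.le, div_eq_inv_mul]
      rw [h3] at h1
      have h4 : C / (1 - q) * (q * r ^ (2 * β + 2)) + C * r ^ (2 * β + 2) =
          C / (1 - q) * r ^ (2 * β + 2) := by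
        have : 1 - q ≠ 0 := by linarith
        field_simp
        ring
      linarith
  intro r hr T hT
  obtain ⟨n, hn⟩ := pow_unbounded_of_one_lt (r / r₁) one_lt_two
  exact key n r hr (by rw [div_lt_iff₀ hr₁] at hn; exact hn.le) T hT

/-- If every disc of radius `R |h|^{-β}` about a far away point `h` has mass at least `1`, then the
disc `|z| < r` has mass at least `c r^{2β+2}`. The centres `h` range over the disc of radius `r / 4`
about `r / 2` when the mass is averaged. -/
lemma exists_disc_lower_bound (hβ : -1 < β) {R : ℝ} (hR : 0 < R) (h₀ : ℝ) :
    ∃ c r₁ : ℝ, 0 < c ∧ ∀ D : ℂ → ℝ, (∀ z, 0 ≤ D z) →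
      (∀ h : ℂ, h₀ ≤ ‖h‖ → ∃ z ∈ ball h (R * ‖h‖ ^ (-β)), 1 ≤ D z) →
      ∀ r ≥ r₁, ∀ T : Finset ℂ, (∀ z ∈ ball (0 : ℂ) r, 1 ≤ D z → z ∈ T) →
        c * r ^ (2 * β + 2) ≤ ∑ z ∈ T, D z := by
  classical
  set K : ℝ := 2 ^ |(-β)| with hK
  have hK0 : 0 < K := by positivity
  obtain ⟨r₀, hr₀⟩ := eventually_atTop.1 (eventually_mul_rpow_neg_le hβ (R * K)
    (show (0 : ℝ) < 1 / 2 by norm_num))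
  refine ⟨2 ^ (-(2 * β + 2)) / (4 * (R * K) ^ 2), max (max (2 * r₀) (4 * h₀)) 1, by positivity, ?_⟩
  intro D hD0 hD r hr T hT
  have hr1 : 0 < r := zero_lt_one.trans_le ((le_max_right _ _).trans hr)
  have hr2 : 4 * h₀ ≤ r := (le_max_right _ _).trans ((le_max_left _ _).trans hr)
  set x := r / 2 with hx
  have hx0 : 0 < x := by positivity
  have hr3 := hr₀ x (by
    have := (le_max_left _ _).trans ((le_max_left _ _).trans hr)
    linarith)
  have hxβ : 0 < x ^ (-β) := Real.rpow_pos_of_pos hx0 _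
  set ρ := R * K * x ^ (-β) with hρ
  have hρ0 : 0 < ρ := by positivity
  have hpt : ∀ h : ℂ, (ball (x : ℂ) (x / 2)).indicator (fun _ => (1 : ℝ)) h ≤
      ∑ z ∈ T, (ball z ρ).indicator (fun _ => D z) h := by
    intro h
    rw [sum_indicator_ball_eq]
    by_cases hmem : h ∈ ball (x : ℂ) (x / 2)
    · rw [Set.indicator_of_mem hmem]
      rw [mem_ball, dist_eq_norm] at hmem
      have a1 := norm_sub_norm_le h x
      have a2 := norm_sub_norm_le (x : ℂ) h
      rw [norm_sub_rev] at a2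
      rw [Complex.norm_real, Real.norm_of_nonneg hx0.le] at a1 a2
      obtain ⟨z, hz, hz1⟩ := hD h (by linarith)
      have b1 := rpow_le_two_rpow_abs_mul (x := x) (y := ‖h‖) (-β) hx0 (by linarith)
        (by linarith)
      have hzρ : z ∈ ball h ρ := by
        refine ball_subset_ball ?_ hz
        rw [hρ, mul_assoc]
        gcongr
      have hzr : z ∈ ball (0 : ℂ) r := by
        rw [mem_ball, dist_eq_norm] at hzρ
        have := norm_sub_norm_le z h
        rw [mem_ball_zero_iff]
        linarith
      exact hz1.trans (Finset.single_le_sum (f := D) (fun z _ => hD0 z)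
        (Finset.mem_filter.2 ⟨hT z hzr hz1, hzρ⟩))
    · rw [Set.indicator_of_notMem hmem]
      exact Finset.sum_nonneg fun z _ => hD0 z
  have hint := integral_mono (integrable_indicator_ball (x : ℂ) (x / 2) 1) (integrable_finsetSum _
    fun z _ => integrable_indicator_ball z ρ (D z)) hpt
  rw [integral_sum_indicator_ball T D hρ0.le, integral_indicator_ball _ (by positivity),
    mul_assoc, mul_assoc, mul_le_mul_iff_right₀ Real.pi_pos] at hint
  have hxr : x ^ (2 * β + 2) = 2 ^ (-(2 * β + 2)) * r ^ (2 * β + 2) := by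
    rw [hx, Real.div_rpow hr1.le two_pos.le, Real.rpow_neg two_pos.le, div_eq_inv_mul]
  rw [div_mul_eq_mul_div, ← hxr, div_le_iff₀ (by positivity)]
  refine le_of_mul_le_mul_right ?_ (show 0 < (x ^ (-β)) ^ 2 by positivity)
  rw [rpow_mul_rpow_neg_sq hx0]
  calc x ^ 2 = 4 * ((x / 2) ^ 2 * 1) := by ring
    _ ≤ 4 * (ρ ^ 2 * ∑ z ∈ T, D z) := by gcongr
    _ = _ := by rw [hρ]; ring

end

/-! ### Counting functions, characteristic and order -/

section

open Metric Function

variable {α β : ℝ} {f : ℂ → ℂ}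

lemma posPart_divisor_apply (hf : Meromorphic f) (z : ℂ) :
    (MeromorphicOn.divisor f Set.univ)⁺ z = zeroMult f z := by
  rw [locallyFinsuppWithin.posPart_apply,
    MeromorphicOn.divisor_apply (fun x _ => hf x) (Set.mem_univ z), zeroMult]

lemma finite_support_inter_closedBall (D : locallyFinsupp ℂ ℤ) (r : ℝ) :
    (D.support ∩ closedBall 0 r).Finite := by
  refine ((locallyFinsuppWithin.toClosedBall r D).finiteSupport
    (isCompact_closedBall 0 |r|)).subset ?_
  rintro z ⟨hz, hzr⟩
  rw [mem_support] at hz ⊢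
  rwa [locallyFinsuppWithin.toClosedBall_eval_within]
  exact closedBall_subset_closedBall (le_abs_self r) hzr

/-- The contribution of a simple point at `z` to the logarithmic counting function at `r`. -/
def logWeight (r : ℝ) (z : ℂ) : ℝ := if z = 0 then Real.log r else Real.posLog (r * ‖z‖⁻¹)

lemma logWeight_nonneg {r : ℝ} (hr : 1 ≤ r) (z : ℂ) : 0 ≤ logWeight r z := by
  rw [logWeight]
  split_ifs
  · exact Real.log_nonneg hr
  · exact Real.posLog_nonneg

lemma log_two_le_logWeight {r : ℝ} (hr : 2 ≤ r) {z : ℂ} (hz : ‖z‖ ≤ r / 2) :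
    Real.log 2 ≤ logWeight r z := by
  rw [logWeight]
  split_ifs with h
  · exact Real.log_le_log two_pos hr
  · have : 0 < ‖z‖ := norm_pos_iff.2 h
    refine (Real.log_le_log two_pos ?_).trans (le_max_right 0 _)
    rw [← div_eq_mul_inv, le_div_iff₀ this]
    linarith

lemma logWeight_le_add {r : ℝ} (hr : 1 ≤ r) (z : ℂ) :
    logWeight r z ≤ logWeight 1 z + Real.log r := by
  rw [logWeight, logWeight]
  split_ifs with h
  · simp
  · rw [one_mul, add_comm, ← Real.posLog_eq_log (x := r) (by rwa [abs_of_pos (by linarith)])]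
    exact Real.posLog_mul

lemma logCounting_eq_sum (D : locallyFinsupp ℂ ℤ) {r : ℝ} (hr : 0 < r) {S : Finset ℂ}
    (hS0 : (0 : ℂ) ∈ S) (hS : D.support ∩ closedBall 0 r ⊆ S) :
    locallyFinsuppWithin.logCounting D r = ∑ z ∈ S, (D z : ℝ) * logWeight r z := by
  have habs : |r| = r := abs_of_pos hr
  have hout : ∀ z ∉ closedBall (0 : ℂ) r, locallyFinsuppWithin.toClosedBall r D z = 0 := by
    intro z hz
    apply locallyFinsuppWithin.apply_eq_zero_of_notMem
    rwa [habs]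
  have hin : ∀ z ∈ closedBall (0 : ℂ) r, locallyFinsuppWithin.toClosedBall r D z = D z := by
    intro z hz
    apply locallyFinsuppWithin.toClosedBall_eval_within
    rwa [habs]
  change ∑ᶠ z, (locallyFinsuppWithin.toClosedBall r D z : ℝ) * Real.log (r * ‖z‖⁻¹)
    + (D 0) * Real.log r = _
  rw [finsum_eq_sum_of_support_subset (s := S)]
  · have h0 : (D 0 : ℝ) * Real.log r = ∑ z ∈ S, if z = 0 then (D 0 : ℝ) * Real.log r else 0 := by
      rw [Finset.sum_ite_eq' S 0, if_pos hS0]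
    rw [h0, ← Finset.sum_add_distrib]
    refine Finset.sum_congr rfl fun z _ => ?_
    rw [logWeight]
    split_ifs with hz
    · simp [hz]
    · have hz0 : 0 < ‖z‖ := norm_pos_iff.2 hz
      rw [add_zero]
      by_cases hzr : z ∈ closedBall (0 : ℂ) r
      · rw [hin z hzr, Real.posLog_eq_log]
        rw [abs_of_pos (by positivity), ← div_eq_mul_inv, one_le_div hz0]
        exact mem_closedBall_zero_iff.1 hzr
      · rw [hout z hzr, (Real.posLog_eq_zero_iff _).2]
        · simp
        · rw [mem_closedBall_zero_iff, not_le] at hzr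
          rw [abs_of_pos (by positivity), ← div_eq_mul_inv, div_le_one hz0]
          exact hzr.le
  · intro z hz
    apply hS
    rw [mem_support] at hz
    by_cases hzr : z ∈ closedBall (0 : ℂ) r
    · refine ⟨fun h => hz ?_, hzr⟩
      rw [hin z hzr, h]
      simp
    · exact absurd (by rw [hout z hzr]; simp) hz

open Classical in
/-- The logarithmic counting function grows by at most the number of points times `log r`. -/
lemma logCounting_le_add (D : locallyFinsupp ℂ ℤ) (hD : ∀ z, 0 ≤ D z) {r B : ℝ} (hr : 1 ≤ r)
    (hB : ∀ T : Finset ℂ, (T : Set ℂ) ⊆ closedBall 0 r → ∑ z ∈ T, (D z : ℝ) ≤ B) :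
    locallyFinsuppWithin.logCounting D r ≤
      locallyFinsuppWithin.logCounting D 1 + B * Real.log r := by
  set S : Finset ℂ := insert 0 (finite_support_inter_closedBall D r).toFinset with hS
  have hr0 : 0 < r := by linarith
  have h1 : D.support ∩ closedBall 0 r ⊆ S := by
    intro z hz
    simp [hS, hz.1, hz.2]
  have h2 : D.support ∩ closedBall 0 1 ⊆ S :=
    (Set.inter_subset_inter_right _ (closedBall_subset_closedBall hr)).trans h1
  have h3 : (S : Set ℂ) ⊆ closedBall 0 r := by
    intro z hz
    simp only [hS, Finset.coe_insert, Set.Finite.coe_toFinset, Set.mem_insert_iff] at hz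
    rcases hz with rfl | hz
    · exact mem_closedBall_self hr0.le
    · exact hz.2
  rw [logCounting_eq_sum D hr0 (by simp [hS]) h1,
    logCounting_eq_sum D one_pos (by simp [hS]) h2]
  calc ∑ z ∈ S, (D z : ℝ) * logWeight r z
      ≤ ∑ z ∈ S, ((D z : ℝ) * logWeight 1 z + D z * Real.log r) := by
        refine Finset.sum_le_sum fun z _ => ?_
        rw [← mul_add]
        exact mul_le_mul_of_nonneg_left (logWeight_le_add hr z) (by exact_mod_cast hD z)
    _ = ∑ z ∈ S, (D z : ℝ) * logWeight 1 z + (∑ z ∈ S, (D z : ℝ)) * Real.log r := by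
        rw [Finset.sum_add_distrib, Finset.sum_mul]
    _ ≤ _ := by
        gcongr
        · exact Real.log_nonneg hr
        · exact hB S h3

open Classical in
lemma sum_mul_log_two_le_logCounting (D : locallyFinsupp ℂ ℤ) (hD : ∀ z, 0 ≤ D z) {r : ℝ}
    (hr : 2 ≤ r) {T : Finset ℂ} (hT : (T : Set ℂ) ⊆ closedBall 0 (r / 2)) :
    (∑ z ∈ T, (D z : ℝ)) * Real.log 2 ≤ locallyFinsuppWithin.logCounting D r := by
  set S : Finset ℂ := insert 0 (finite_support_inter_closedBall D r).toFinset ∪ T with hS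
  rw [logCounting_eq_sum D (show 0 < r by linarith) (S := S) (by simp [hS])
    (fun z hz => by simp [hS, hz.1, hz.2]), Finset.sum_mul]
  refine (Finset.sum_le_sum fun z hz => ?_).trans (Finset.sum_le_sum_of_subset_of_nonneg
    (Finset.subset_union_right : T ⊆ S) fun z _ _ =>
      mul_nonneg (by exact_mod_cast hD z) (logWeight_nonneg (by linarith) z))
  exact mul_le_mul_of_nonneg_left
    (log_two_le_logWeight hr (mem_closedBall_zero_iff.1 (hT hz))) (by exact_mod_cast hD z)

lemma exists_finset_zeroCount_eq (hf : Meromorphic f) (r : ℝ) :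
    ∃ S : Finset ℂ, (S : Set ℂ) ⊆ closedBall 0 r ∧
      (∀ z ∈ ball (0 : ℂ) r, (1 : ℝ) ≤ zeroMult f z → z ∈ S) ∧
      (zeroCount f r : ℝ) = ∑ z ∈ S, (zeroMult f z : ℝ) := by
  have hfin : (ball (0 : ℂ) r ∩ (MeromorphicOn.divisor f Set.univ)⁺.support).Finite :=
    (finite_support_inter_closedBall _ r).subset fun z hz => ⟨hz.2, ball_subset_closedBall hz.1⟩
  refine ⟨hfin.toFinset, ?_, ?_, ?_⟩
  · intro z hz
    rw [Set.Finite.coe_toFinset] at hz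
    exact ball_subset_closedBall hz.1
  · intro z hz h1
    rw [Set.Finite.mem_toFinset]
    refine ⟨hz, ?_⟩
    rw [mem_support, posPart_divisor_apply hf]
    intro h0
    rw [h0] at h1
    norm_num at h1
  · rw [zeroCount, finsum_mem_eq_sum_of_inter_support_eq (t := hfin.toFinset)]
    · push_cast
      exact Finset.sum_congr rfl fun z _ => by rw [posPart_divisor_apply hf]
    · rw [Set.Finite.coe_toFinset, Set.inter_assoc, Set.inter_self]

lemma poleCount_eq_zeroCount_inv (f : ℂ → ℂ) (r : ℝ) : poleCount f r = zeroCount f⁻¹ r := by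
  rw [poleCount, zeroCount, MeromorphicOn.divisor_inv, posPart_neg]

lemma IsGeneralisedYosida.exists_one_le_zeroMult (hβ : -1 < β)
    (hf : IsGeneralisedYosida α β f) :
    ∃ R > 0, ∃ h₀ : ℝ, ∀ h : ℂ, h₀ ≤ ‖h‖ →
      ∃ z ∈ ball h (R * ‖h‖ ^ (-β)), (1 : ℝ) ≤ zeroMult f z := by
  obtain ⟨R, hR, h₀, hz⟩ := hf.exists_zero hβ
  refine ⟨R, hR, h₀, fun h hh => ?_⟩
  obtain ⟨z, hzb, hz0⟩ := hz h hh
  refine ⟨z, hzb, ?_⟩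
  rw [sphereValue_eq_zero_iff (hf.meromorphic z)] at hz0
  have := hf.meromorphicOrderAt_ne_top z
  rw [zeroMult]
  lift meromorphicOrderAt f z to ℤ using this with k
  have hk : 0 < k := by exact_mod_cast hz0
  rw [WithTop.untop₀_coe, posPart_eq_self.2 hk.le]
  exact_mod_cast hk

lemma IsGeneralisedYosida.exists_le_zeroMult_sum (hβ : -1 < β) (hf : IsGeneralisedYosida α β f) :
    ∃ c r₁ : ℝ, 0 < c ∧ ∀ r ≥ r₁, ∀ T : Finset ℂ,
      (∀ z ∈ ball (0 : ℂ) r, (1 : ℝ) ≤ zeroMult f z → z ∈ T) →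
        c * r ^ (2 * β + 2) ≤ ∑ z ∈ T, (zeroMult f z : ℝ) := by
  obtain ⟨R, hR, h₀, hz⟩ := hf.exists_one_le_zeroMult hβ
  obtain ⟨c, r₁, hc, h⟩ := exists_disc_lower_bound hβ hR h₀
  exact ⟨c, r₁, hc, h _ (fun z => by exact_mod_cast zeroMult_nonneg f z) hz⟩

/-- The number of solutions of `f = a` in `|z| ≤ r` is `O(r^{2β+2})`, uniformly for `|a| ≤ 1`. For
`a ≠ 0` this needs `0 ≤ α`: only then do the rescaled targets `h^{-α} a` stay bounded. -/
lemma IsGeneralisedYosida.exists_zeroMult_sum_le (hβ : -1 < β) (hf : IsGeneralisedYosida α β f) :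
    ∃ C N : ℝ, 0 ≤ C ∧ ∀ a : ℂ, ‖a‖ ≤ 1 → (a = 0 ∨ 0 ≤ α) → ∀ r > 0, ∀ T : Finset ℂ,
      (T : Set ℂ) ⊆ closedBall 0 r →
        ∑ z ∈ T, (zeroMult (fun w => f w - a) z : ℝ) ≤ C * r ^ (2 * β + 2) + N := by
  obtain ⟨δ, hδ, N, h₀, hloc⟩ := hf.exists_sum_zeroMult_le
  obtain ⟨C, r₁, hC, h⟩ := exists_disc_bound hβ hδ N (max h₀ 1)
  obtain ⟨B, hB⟩ := hf.exists_sum_zeroMult_le_closedBall r₁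
  refine ⟨C, B, hC, fun a ha haα => h _ (fun x hx => ?_) B (hB a ha)⟩
  refine hloc x ((le_max_left _ _).trans hx) a ?_
  rcases haα with rfl | hα
  · simp
  · have h1 : 1 ≤ ‖x‖ := (le_max_right _ _).trans hx
    exact mul_le_one₀ (Real.rpow_le_one_of_one_le_of_nonpos h1 (by linarith)) (norm_nonneg a) ha

lemma IsGeneralisedYosida.zeroCount_isTheta (hβ : -1 < β) (hf : IsGeneralisedYosida α β f) :
    (fun r : ℝ => (zeroCount f r : ℝ)) =Θ[atTop] (fun r : ℝ => r ^ (2 * β + 2)) := by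
  obtain ⟨C, N, hC, hup⟩ := hf.exists_zeroMult_sum_le hβ
  obtain ⟨c, r₁, hc, hlow⟩ := hf.exists_le_zeroMult_sum hβ
  have hnn : ∀ r, 0 ≤ (zeroCount f r : ℝ) := by
    intro r
    obtain ⟨S, -, -, hS⟩ := exists_finset_zeroCount_eq hf.meromorphic r
    rw [hS]
    exact Finset.sum_nonneg fun z _ => by exact_mod_cast zeroMult_nonneg f z
  constructor
  · refine IsBigO.of_bound (C + |N|) ?_
    filter_upwards [eventually_ge_atTop 1] with r hr
    obtain ⟨S, hSr, -, hS⟩ := exists_finset_zeroCount_eq hf.meromorphic r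
    have h1 := hup 0 (by simp) (Or.inl rfl) r (by linarith) S hSr
    simp only [sub_zero] at h1
    have h2 : 1 ≤ r ^ (2 * β + 2) := Real.one_le_rpow hr (by linarith)
    rw [Real.norm_of_nonneg (hnn r), Real.norm_of_nonneg (by linarith), hS]
    nlinarith [le_abs_self N, abs_nonneg N]
  · refine IsBigO.of_bound c⁻¹ ?_
    filter_upwards [eventually_ge_atTop r₁, eventually_ge_atTop 0] with r hr hr0
    obtain ⟨S, -, hSr, hS⟩ := exists_finset_zeroCount_eq hf.meromorphic r
    have h1 := hlow r hr S hSr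
    rw [Real.norm_of_nonneg (hnn r), Real.norm_of_nonneg (Real.rpow_nonneg hr0 _), hS,
      ← div_eq_inv_mul, le_div_iff₀ hc, mul_comm]
    exact h1

/-- The characteristic is at least the logarithmic counting function of the poles. -/
lemma IsGeneralisedYosida.exists_le_characteristic (hβ : -1 < β)
    (hf : IsGeneralisedYosida α β f) :
    ∃ c > 0, ∀ᶠ r : ℝ in atTop,
      c * r ^ (2 * β + 2) ≤ ValueDistribution.characteristic f ⊤ r := by
  obtain ⟨c, r₁, hc, hlow⟩ := hf.inv.exists_le_zeroMult_sum hβ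
  refine ⟨c * 2 ^ (-(2 * β + 2)) * Real.log 2,
    by have := Real.log_pos one_lt_two; positivity, ?_⟩
  filter_upwards [eventually_ge_atTop (2 * r₁), eventually_ge_atTop 2] with r hr hr2
  obtain ⟨S, hSr, hS1, -⟩ := exists_finset_zeroCount_eq hf.inv.meromorphic (r / 2)
  have h1 := hlow (r / 2) (by linarith) S hS1
  have h2 := sum_mul_log_two_le_logCounting (MeromorphicOn.divisor f⁻¹ Set.univ)⁺
    (fun z => by rw [posPart_divisor_apply hf.inv.meromorphic]; exact zeroMult_nonneg _ _) hr2 hSr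
  simp only [posPart_divisor_apply hf.inv.meromorphic] at h2
  rw [MeromorphicOn.divisor_inv, posPart_neg, ← ValueDistribution.logCounting_top] at h2
  have h3 : 0 ≤ ValueDistribution.proximity f ⊤ r := ValueDistribution.proximity_nonneg r
  have h4 : (r / 2) ^ (2 * β + 2) = 2 ^ (-(2 * β + 2)) * r ^ (2 * β + 2) := by
    rw [Real.div_rpow (by linarith) two_pos.le, Real.rpow_neg two_pos.le, div_eq_inv_mul]
  rw [h4] at h1
  have h5 := mul_le_mul_of_nonneg_right h1 (Real.log_nonneg one_le_two)
  simp only [ValueDistribution.characteristic, Pi.add_apply]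
  linarith

/-- By Cartan's formula the characteristic is, up to a constant, the average of the logarithmic
counting functions of the points where `f = a`, over `|a| = 1`. Only their increments from radius
`1` to radius `r` are estimated: near `0` they are not bounded uniformly in `a`. -/
lemma IsGeneralisedYosida.exists_characteristic_le_of_nonneg (hβ : -1 < β) (hα : 0 ≤ α)
    (hf : IsGeneralisedYosida α β f) :
    ∃ C > 0, ∀ᶠ r : ℝ in atTop,
      ValueDistribution.characteristic f ⊤ r ≤ C * (r ^ (2 * β + 2) * Real.log r) := by
  obtain ⟨C, N, hC, hup⟩ := hf.exists_zeroMult_sum_le hβ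
  obtain ⟨k, hk⟩ := ValueDistribution.characteristic_top_eq_circleAverage_add_const hf.meromorphic
  set T₁ := ValueDistribution.characteristic f ⊤ 1 with hT₁
  refine ⟨C + |N| + |T₁| + 1, by positivity, ?_⟩
  filter_upwards [eventually_ge_atTop (Real.exp 1)] with r hr
  have hr1 : 1 ≤ r := (Real.one_le_exp zero_le_one).trans hr
  have hlog : 1 ≤ Real.log r := by
    rw [← Real.log_exp 1]
    exact Real.log_le_log (Real.exp_pos 1) hr
  have hpow : 1 ≤ r ^ (2 * β + 2) := Real.one_le_rpow hr1 (by linarith)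
  set B := C * r ^ (2 * β + 2) + N with hBdef
  have hmono : Real.circleAverage (fun a : ℂ => ValueDistribution.logCounting f a r) 0 1 ≤
      Real.circleAverage (fun a : ℂ => ValueDistribution.logCounting f a 1 + B * Real.log r) 0 1 := by
    apply Real.circleAverage_mono (ValueDistribution.circleIntegrable_logCounting hf.meromorphic)
      ((ValueDistribution.circleIntegrable_logCounting hf.meromorphic).add
        (circleIntegrable_const _ _ _))
    intro a ha
    rw [abs_one, mem_sphere_zero_iff_norm] at ha
    rw [ValueDistribution.logCounting_coe]
    have hm : Meromorphic fun z => f z - a := fun z => (hf.meromorphic z).sub (.const a z)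
    apply logCounting_le_add _ _ hr1
    · intro T hT
      simp only [posPart_divisor_apply hm]
      exact hup a ha.le (Or.inr hα) r (by linarith) T hT
    · intro z
      rw [posPart_divisor_apply hm]
      exact zeroMult_nonneg _ _
  have hadd : Real.circleAverage
      (fun a : ℂ => ValueDistribution.logCounting f a 1 + B * Real.log r) 0 1 =
      Real.circleAverage (fun a : ℂ => ValueDistribution.logCounting f a 1) 0 1
        + B * Real.log r := by
    rw [Real.circleAverage_fun_add (ValueDistribution.circleIntegrable_logCounting hf.meromorphic)
      (circleIntegrable_const _ _ _), Real.circleAverage_const]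
  have e1 := hk r (by linarith)
  have e2 := hk 1 one_ne_zero
  have h1 : ValueDistribution.characteristic f ⊤ r ≤ T₁ + B * Real.log r := by
    rw [hT₁, e1, e2]
    linarith
  have hX : Real.log r ≤ r ^ (2 * β + 2) * Real.log r := by nlinarith
  have hX1 : 1 ≤ r ^ (2 * β + 2) * Real.log r := hlog.trans hX
  calc ValueDistribution.characteristic f ⊤ r ≤ T₁ + B * Real.log r := h1
    _ = T₁ + C * (r ^ (2 * β + 2) * Real.log r) + N * Real.log r := by rw [hBdef]; ring
    _ ≤ |T₁| * (r ^ (2 * β + 2) * Real.log r) + C * (r ^ (2 * β + 2) * Real.log r)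
        + |N| * (r ^ (2 * β + 2) * Real.log r) := by
      have b1 : T₁ ≤ |T₁| * (r ^ (2 * β + 2) * Real.log r) :=
        (le_abs_self _).trans (le_mul_of_one_le_right (abs_nonneg _) hX1)
      have b2 : N * Real.log r ≤ |N| * (r ^ (2 * β + 2) * Real.log r) :=
        mul_le_mul (le_abs_self N) hX (by linarith) (abs_nonneg N)
      linarith
    _ ≤ _ := by linarith

/-- For `α ≤ 0` the bound comes from `f⁻¹`, by the first main theorem. -/
lemma IsGeneralisedYosida.exists_characteristic_le (hβ : -1 < β) (hf : IsGeneralisedYosida α β f) :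
    ∃ C > 0, ∀ᶠ r : ℝ in atTop,
      ValueDistribution.characteristic f ⊤ r ≤ C * (r ^ (2 * β + 2) * Real.log r) := by
  rcases le_total 0 α with hα | hα
  · exact hf.exists_characteristic_le_of_nonneg hβ hα
  obtain ⟨C, hC, h⟩ := hf.inv.exists_characteristic_le_of_nonneg hβ (by linarith)
  set k := Real.log ‖meromorphicTrailingCoeffAt f 0‖ with hk
  refine ⟨C + |k|, by positivity, ?_⟩
  filter_upwards [h, eventually_ge_atTop (Real.exp 1)] with r h1 hr
  have hr1 : 1 ≤ r := (Real.one_le_exp zero_le_one).trans hr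
  have hlog : 1 ≤ Real.log r := by
    rw [← Real.log_exp 1]
    exact Real.log_le_log (Real.exp_pos 1) hr
  have hpow : 1 ≤ r ^ (2 * β + 2) := Real.one_le_rpow hr1 (by linarith)
  have h2 := ValueDistribution.characteristic_sub_characteristic_inv_of_ne_zero hf.meromorphic
    (show r ≠ 0 by linarith)
  have h3 : 1 ≤ r ^ (2 * β + 2) * Real.log r := by nlinarith
  have h4 : k ≤ |k| * (r ^ (2 * β + 2) * Real.log r) :=
    (le_abs_self _).trans (le_mul_of_one_le_right (abs_nonneg _) h3)
  linarith

lemma tendsto_log_div_log {T : ℝ → ℝ} {p c C : ℝ} (hc : 0 < c) (hC : 0 < C)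
    (hlow : ∀ᶠ r in atTop, c * r ^ p ≤ T r)
    (hup : ∀ᶠ r in atTop, T r ≤ C * (r ^ p * Real.log r)) :
    Tendsto (fun r => Real.log (T r) / Real.log r) atTop (𝓝 p) := by
  have hinv : Tendsto (fun r : ℝ => (Real.log r)⁻¹) atTop (𝓝 0) :=
    tendsto_inv_atTop_zero.comp Real.tendsto_log_atTop
  have hloglog : Tendsto (fun r : ℝ => Real.log (Real.log r) / Real.log r) atTop (𝓝 0) :=
    (Real.isLittleO_log_id_atTop.tendsto_div_nhds_zero).comp Real.tendsto_log_atTop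
  have h1 : Tendsto (fun r : ℝ => Real.log c * (Real.log r)⁻¹ + p) atTop (𝓝 p) := by
    simpa using (hinv.const_mul (Real.log c)).add_const p
  have h2 : Tendsto (fun r : ℝ => Real.log C * (Real.log r)⁻¹ + p
      + Real.log (Real.log r) / Real.log r) atTop (𝓝 p) := by
    simpa using ((hinv.const_mul (Real.log C)).add_const p).add hloglog
  refine tendsto_of_tendsto_of_tendsto_of_le_of_le' h1 h2 ?_ ?_
  · filter_upwards [hlow, eventually_gt_atTop 1] with r hr hr1
    have hlog := Real.log_pos hr1
    have hp : 0 < r ^ p := Real.rpow_pos_of_pos (by linarith) p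
    rw [le_div_iff₀ hlog, add_mul, inv_mul_cancel_right₀ hlog.ne',
      ← Real.log_rpow (by linarith), ← Real.log_mul hc.ne' hp.ne']
    exact Real.log_le_log (by positivity) hr
  · filter_upwards [hlow, hup, eventually_gt_atTop 1] with r hr0 hr hr1
    have hlog := Real.log_pos hr1
    have hp : 0 < r ^ p := Real.rpow_pos_of_pos (by linarith) p
    rw [div_le_iff₀ hlog, add_mul, add_mul, inv_mul_cancel_right₀ hlog.ne',
      div_mul_cancel₀ _ hlog.ne', ← Real.log_rpow (by linarith), add_assoc,
      ← Real.log_mul hp.ne' hlog.ne', ← Real.log_mul hC.ne' (by positivity)]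
    exact Real.log_le_log (lt_of_lt_of_le (by positivity) hr0) hr

end

end

end GeneralisedYosida

theorem theorem10 (α β : ℝ) (hβ : -1 < β) (f : ℂ → ℂ)
    (hf : GeneralisedYosida.IsGeneralisedYosida α β f) :
    (fun r : ℝ => (GeneralisedYosida.zeroCount f r : ℝ)) =Θ[atTop]
        (fun r : ℝ => r ^ (2 * β + 2)) ∧
      (fun r : ℝ => (GeneralisedYosida.poleCount f r : ℝ)) =Θ[atTop]
        (fun r : ℝ => r ^ (2 * β + 2)) ∧
      GeneralisedYosida.orderOfGrowth f = ((2 * β + 2 : ℝ) : EReal) := by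
  refine ⟨hf.zeroCount_isTheta hβ, ?_, ?_⟩
  · simp only [GeneralisedYosida.poleCount_eq_zeroCount_inv]
    exact hf.inv.zeroCount_isTheta hβ
  · obtain ⟨c, hc, hlow⟩ := hf.exists_le_characteristic hβ
    obtain ⟨C, hC, hup⟩ := hf.exists_characteristic_le hβ
    exact ((continuous_coe_real_ereal.tendsto _).comp
      (GeneralisedYosida.tendsto_log_div_log hc hC hlow hup)).limsup_eq
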